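/- **Setting.** There are $K$ arms. The rewards of arm $i$ are i.i.d. with an unknown distribution supported in $[0,1]$ and mean $\mu_i$, and are independent across arms. Let $\mu^*=\max_i\mu_i$ and $\Delta_i=\mu^*-\mu_i$; arm $i$ is suboptimal if $\Delta_i>0$. Let $k_i(t)$ be the number of plays of arm $i$ before round $t$ and let $\hat\mu_i(t)$ be the sum of the rewards observed from arm $i$ before round $t$, divided by $k_i(t)+1$. Thompson sampling with virtual helping agents using Gaussian priors works as follows. In round $t$, $N$ agents draw, independently across agents, arms and rounds, samples $\theta_{i,n}(t)\sim\mathcal N\big(\hat\mu_i(t),\frac1{k_i(t)+1}\big)$ ($n=1,\dots,N$) for every arm $i$. A fixed combiner $f$ forms $\theta_i(t)=f(\theta_{i,1}(t),\dots,\theta_{i,N}(t))$. The arm $i(t)=\arg\max_i\theta_i(t)$ is played and its reward observed. The combiner has variance scaling factor $\gamma>0$: applied to $N$ independent $\mathcal N(m,v)$ samples, it returns an $\mathcal N(m,v/\gamma)$ variable, for all $m$ and all $v>0$ (for example $f(\theta)=\frac1N\sum_n\theta_n$ with $\gamma=N$). The regret is $R(T)=\sum_{t=1}^T(\mu^*-\mu_{i(t)})$.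 **Constants.** Let $\beta\in[1,2)$ and $\epsilon>0$. Let $h(\beta)>0$ be any number such that $\exp\!\big(-r^{1-\beta/2}/\sqrt{2\beta\pi\ln r}\big)\le r^{-2}$ for all integers $r\ge h(\beta)$, $r\ge2$, and put $H(\beta)=4(h(\beta)+\zeta(2))$, where $\zeta$ is the Riemann zeta function. For every suboptimal arm $i$, let $g_i(\epsilon)>0$ be any number such that $$\frac{\exp\!\big(4\sqrt{\beta\ln r/\gamma}\,(1-\Delta_i/3)\big)}{r^{2\beta/\gamma}}\le\frac1{r^{2\beta/\gamma-\epsilon}}$$ for all integers $r\ge g_i(\epsilon)$, $r\ge1$. Put $x_i=\mu_i+\Delta_i/3$, $y_i=\mu^*-\Delta_i/3$, $$c_i=\frac{2(H(\beta)+1)\Delta_i}{\gamma(y_i-x_i)^2},\qquad c_i'=\frac{e^{4\Delta_i/3}}{e^{2\Delta_i^2/9}-1},$$ and $\ln^+x=\max(0,\ln x)$. **Theorem 1.** Let $T\ge K$. (a) If $\gamma\in(0,4)$ and $\frac{2\beta}\gamma-\epsilon>1$, then $$\mathbb E[R(T)]\le\sum_{i:\Delta_i>0}\Big(c_i\ln^+(T\Delta_i^2)+\Big(c_i'\Big(g_i(\epsilon)+\zeta\big(\tfrac{2\beta}\gamma-\epsilon\big)\Big)+1\Big)\Delta_i+\frac{9.5}{\Delta_i}\Big).$$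 (b) If $\gamma\ge4$, then $$\mathbb E[R(T)]\le\sum_{i:\Delta_i>0}\Big(c_i\ln^+(T\Delta_i^2)+c_i'\Big(\frac{T^{1+\epsilon-2\beta/\gamma}-1}{1+\epsilon-2\beta/\gamma}+g_i(\epsilon)+1\Big)\Delta_i+\frac{9.5}{\Delta_i}\Big).$$ -/

import Mathlib

open MeasureTheory ProbabilityTheory

noncomputable section

namespace TSVHA

/-! ## The bandit -/

/-- A `K`-armed stochastic bandit: one reward distribution per arm, supported in `[0, 1]`. -/
structure Bandit (K : ℕ) where
  /-- the reward distribution of each arm -/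
  law : Fin K → Measure ℝ
  isProb : ∀ i, IsProbabilityMeasure (law i)
  support : ∀ i, ∀ᵐ x ∂(law i), x ∈ Set.Icc (0 : ℝ) 1

/-- Expected reward `μ i` of arm `i`. -/
def Bandit.mean {K : ℕ} (B : Bandit K) (i : Fin K) : ℝ := ∫ x, x ∂(B.law i)

/-- The largest expected reward `μ*`. -/
def Bandit.best {K : ℕ} (B : Bandit K) : ℝ := ⨆ i, B.mean i

/-- The gap `Δ i = μ* - μ i`. -/
def Bandit.gap {K : ℕ} (B : Bandit K) (i : Fin K) : ℝ := B.best - B.mean i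

/-! ## The algorithm -/

/-- A rule that selects an index of a largest coordinate (with some measurable way of breaking
ties). -/
def IsArgmaxRule {K : ℕ} (sel : (Fin K → ℝ) → Fin K) : Prop :=
  Measurable sel ∧ ∀ (v : Fin K → ℝ) (j : Fin K), v j ≤ v (sel v)

/-- The combiner `f` has variance scaling factor `γ`: applied to `N` independent samples of a
Gaussian distribution, it returns a Gaussian with the same mean and with the variance multiplied
by `1 / γ`. For a linear combiner with coefficients `c n` this says `∑ c n = 1` and
`∑ (c n) ^ 2 = 1 / γ`. -/
def HasVarianceScaling {N : ℕ} (f : (Fin N → ℝ) → ℝ) (γ : ℝ) : Prop :=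
  Measurable f ∧ ∀ (m : ℝ) (v : NNReal), 0 < v →
    (Measure.pi fun _ : Fin N => gaussianReal m v).map f
      = gaussianReal m (Real.toNNReal ((v : ℝ) / γ))

section Run

variable {K N : ℕ}

/-- The posterior mean of arm `i` when the arms have been played `k` times: the sum of the rewards
observed from arm `i`, divided by `k i + 1`. Here `y i j` is the reward that arm `i` gives when it
is played for the `(j + 1)`-st time. -/
def postMean (y : Fin K → ℕ → ℝ) (k : Fin K → ℕ) (i : Fin K) : ℝ :=
  (∑ j ∈ Finset.range (k i), y i j) / ((k i : ℝ) + 1)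

/-- The sample that agent `n` draws for arm `i` from the posterior with mean `postMean y k i` and
variance `1 / (k i + 1)`, produced from a standard Gaussian `z i n`. -/
def agentSample (y : Fin K → ℕ → ℝ) (k : Fin K → ℕ) (z : Fin K → Fin N → ℝ)
    (i : Fin K) (n : Fin N) : ℝ :=
  postMean y k i + z i n / Real.sqrt ((k i : ℝ) + 1)

/-- The combined sample of arm `i`. -/
def combinedSample (f : (Fin N → ℝ) → ℝ) (y : Fin K → ℕ → ℝ) (k : Fin K → ℕ)
    (z : Fin K → Fin N → ℝ) (i : Fin K) : ℝ :=
  f fun n => agentSample y k z i n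

/-- The arm chosen when the arms have been played `k` times: the one with the largest combined
sample. -/
def chooseArm (sel : (Fin K → ℝ) → Fin K) (f : (Fin N → ℝ) → ℝ) (y : Fin K → ℕ → ℝ)
    (k : Fin K → ℕ) (z : Fin K → Fin N → ℝ) : Fin K :=
  sel fun i => combinedSample f y k z i

/-- `plays sel f y z t i` is the number of plays of arm `i` in the first `t` rounds. Rounds are
numbered from `0`, and `z t` is the Gaussian noise used in round `t`. -/
def plays (sel : (Fin K → ℝ) → Fin K) (f : (Fin N → ℝ) → ℝ) (y : Fin K → ℕ → ℝ)
    (z : ℕ → Fin K → Fin N → ℝ) : ℕ → Fin K → ℕ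
  | 0 => fun _ => 0
  | t + 1 => fun i =>
      plays sel f y z t i + if chooseArm sel f y (plays sel f y z t) (z t) = i then 1 else 0

/-- The arm played in round `t`. -/
def armAt (sel : (Fin K → ℝ) → Fin K) (f : (Fin N → ℝ) → ℝ) (y : Fin K → ℕ → ℝ)
    (z : ℕ → Fin K → Fin N → ℝ) (t : ℕ) : Fin K :=
  chooseArm sel f y (plays sel f y z t) (z t)

/-- The regret accumulated in the first `T` rounds. -/
def regret (B : Bandit K) (sel : (Fin K → ℝ) → Fin K) (f : (Fin N → ℝ) → ℝ)
    (y : Fin K → ℕ → ℝ) (z : ℕ → Fin K → Fin N → ℝ) (T : ℕ) : ℝ :=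
  ∑ t ∈ Finset.range T, (B.best - B.mean (armAt sel f y z t))

/-- The randomness of a run: `Y i j`, the reward of the `(j + 1)`-st play of arm `i`, has the reward
distribution of arm `i`; the sampling noises `Z t i n` are standard Gaussian; all of them are
independent. -/
structure IsRandomSource {Ω : Type*} [MeasurableSpace Ω] (B : Bandit K) (P : Measure Ω)
    (Y : Fin K → ℕ → Ω → ℝ) (Z : ℕ → Fin K → Fin N → Ω → ℝ) : Prop where
  measurable_reward : ∀ i j, Measurable (Y i j)
  measurable_noise : ∀ t i n, Measurable (Z t i n)
  law_reward : ∀ i j, P.map (Y i j) = B.law i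
  law_noise : ∀ t i n, P.map (Z t i n) = gaussianReal 0 1
  indep : iIndepFun
    (Sum.elim (fun p : Fin K × ℕ => Y p.1 p.2)
      (fun q : ℕ × Fin K × Fin N => Z q.1 q.2.1 q.2.2)) P

end Run

/-! ## The constants of the bound -/

/-- `h` is a threshold beyond which `exp (- r ^ (1 - β / 2) / √(2 β π ln r)) ≤ 1 / r ^ 2`. -/
def IsThresholdH (β h : ℝ) : Prop :=
  0 < h ∧ ∀ r : ℕ, 1 < r → h ≤ r →
    Real.exp (-((r : ℝ) ^ (1 - β / 2) / Real.sqrt (2 * β * Real.pi * Real.log r)))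
      ≤ 1 / (r : ℝ) ^ 2

/-- `g` is a threshold beyond which
`exp (4 √(β ln r / γ) (1 - Δ / 3)) / r ^ (2 β / γ) ≤ 1 / r ^ (2 β / γ - ε)`. -/
def IsThresholdG (γ β ε Δ g : ℝ) : Prop :=
  0 < g ∧ ∀ r : ℕ, 1 ≤ r → g ≤ r →
    Real.exp (4 * Real.sqrt (β * Real.log r / γ) * (1 - Δ / 3)) / (r : ℝ) ^ (2 * β / γ)
      ≤ 1 / (r : ℝ) ^ (2 * β / γ - ε)

/-- The Riemann zeta function at a real argument. -/
def zetaReal (s : ℝ) : ℝ := (riemannZeta (s : ℂ)).re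

/-- `H = 4 (h + ζ(2))`. -/
def bigH (h : ℝ) : ℝ := 4 * (h + zetaReal 2)

/-- `c' = exp (4 Δ / 3) / (exp (2 Δ ^ 2 / 9) - 1)`. -/
def cPrime (Δ : ℝ) : ℝ := Real.exp (4 * Δ / 3) / (Real.exp (2 * Δ ^ 2 / 9) - 1)

/-- The threshold `x i = μ i + Δ i / 3`. -/
def Bandit.lower {K : ℕ} (B : Bandit K) (i : Fin K) : ℝ := B.mean i + B.gap i / 3

/-- The threshold `y i = μ* - Δ i / 3`. -/
def Bandit.upper {K : ℕ} (B : Bandit K) (i : Fin K) : ℝ := B.best - B.gap i / 3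

/-- `c i = 2 (H + 1) Δ i / (γ (y i - x i) ^ 2)`. -/
def Bandit.logCoeff {K : ℕ} (B : Bandit K) (γ h : ℝ) (i : Fin K) : ℝ :=
  2 * (bigH h + 1) * B.gap i / (γ * (B.upper i - B.lower i) ^ 2)

/-- The suboptimal arms. -/
def Bandit.suboptimal {K : ℕ} (B : Bandit K) : Finset (Fin K) :=
  Finset.univ.filter fun i => B.mean i < B.best

end TSVHA

end

/-! The regret is the sum over suboptimal arms of the gap times the number of plays, so everything
rests on a bound for the expected plays of one suboptimal arm `i`, compared with an optimal arm `o`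
(`IsRandomSource.expected_plays_bound`). Write Δ for the gap and fix levels x < c < z between the
two means. A play of `i` falls in one of three classes: its average exceeds x; its average is at
most x but its sample exceeds c; its sample is at most c. Hoeffding's inequality bounds the first
class by a constant over Δ². Once `i` has been played R times, with R of order ln(TΔ²)/(γΔ²), the
second class is negligible by Gaussian concentration.

The third class is charged to `o`. If `i` wins with a sample at most c, all samples are at most c.
Given the history the samples are independent, and if only the sample of `o` exceeded c, then `o`
would win. So the event has at most 1/p - 1 times the probability that `o` is played, where p is the
chance that the sample of `o` exceeds c (`noiseLaw_small_sample_le`). Each play count j of `o`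
occurs at most once among its plays, so summing over rounds leaves the sum over j of E[min(odds_j,
T)], where odds_j depends only on the first j rewards of `o` (`IsRandomSource.sum_small_sample_le`).

A layer-cake argument reduces this to the probabilities that odds_j > r. Any r ≥ 1 forces the
average of `o` below c, and summing over j costs c'. For r ≥ h the average must lie lower by a
further √(β ln r / γ)/√(j+1), and Hoeffding gains the factor exp(4√(β ln r / γ)(1 - Δ/3)) /
r^(2β/γ). By the choice of g this is at most r^(-(2β/γ - ε)) for r ≥ g. Summing over r gives g plus
a zeta value or an integral.

The levels r < h remain, and so do explicit numerical constants; the logarithmic term pays for both.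
Any admissible h exceeds 10000 and H ≥ 4h. Let L = 18 ln(TΔ²)/(γΔ²). If γ ≤ 2 ln(TΔ²), then c'h ≤
2hL. Otherwise either T ≤ HL, and there is nothing to prove, or ln h ≤ 8γ/9, and then the levels
below h already have weight at least 1 in the sum over r. -/

namespace TSVHA

/-! ## Gaussian tails -/

/-- The probability that a standard Gaussian variable exceeds `w`. -/
noncomputable def upperTail (w : ℝ) : ℝ := (gaussianReal 0 1).real (Set.Ioi w)

theorem upperTail_antitone : Antitone upperTail := fun _ _ hab =>
  measureReal_mono (Set.Ioi_subset_Ioi hab)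

theorem upperTail_le_one (w : ℝ) : upperTail w ≤ 1 := measureReal_le_one

theorem upperTail_nonneg (w : ℝ) : 0 ≤ upperTail w := measureReal_nonneg

theorem upperTail_neg (w : ℝ) : upperTail (-w) = 1 - upperTail w := by
  have : NullSingletonClass (gaussianReal 0 1) := nullSingletonClass_gaussianReal one_ne_zero
  have hmap : (gaussianReal 0 1).map (fun x => -x) = gaussianReal 0 1 := by
    simpa using gaussianReal_map_neg (μ := 0) (v := 1)
  have h1 : upperTail (-w) = (gaussianReal 0 1).real (Set.Iic w) := by
    rw [upperTail, ← hmap, map_measureReal_apply measurable_neg measurableSet_Ioi, hmap]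
    have : (fun x : ℝ => -x) ⁻¹' Set.Ioi (-w) = Set.Iio w := by ext x; simp
    rw [this]
    exact measureReal_congr Iio_ae_eq_Iic
  rw [h1, upperTail, ← Set.compl_Ioi, probReal_compl_eq_one_sub measurableSet_Ioi]

theorem half_le_upperTail {w : ℝ} (hw : w ≤ 0) : 1 / 2 ≤ upperTail w := by
  have h1 := upperTail_neg w
  have h2 : upperTail (-w) ≤ upperTail w := upperTail_antitone (by linarith)
  linarith

theorem upperTail_le_exp {w : ℝ} (hw : 0 ≤ w) : upperTail w ≤ Real.exp (-w ^ 2 / 2) := by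
  have hs : HasSubgaussianMGF (fun x : ℝ => x) 1 (gaussianReal 0 1) :=
    ⟨fun t => integrable_exp_mul_gaussianReal t, fun t => by
      rw [mgf_fun_id_gaussianReal]; simp⟩
  refine (measureReal_mono fun x hx => ?_).trans ((hs.measure_ge_le hw).trans_eq (by simp))
  exact le_of_lt (Set.mem_Ioi.1 hx)

/-- On an interval of length 1/w the density is at least its value at the right end. For w ≥ 1 this
loses only a constant factor, which the threshold `h` has room to absorb. -/
theorem le_upperTail {w : ℝ} (hw : 0 < w) :
    Real.exp (-(w + 1 / w) ^ 2 / 2) / (w * Real.sqrt (2 * Real.pi)) ≤ upperTail w := by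
  have h1 : 0 < 1 / w := by positivity
  have hpdf : ∀ x ∈ Set.Ioc w (w + 1 / w),
      Real.exp (-(w + 1 / w) ^ 2 / 2) / Real.sqrt (2 * Real.pi) ≤ gaussianPDFReal 0 1 x := by
    intro x hx
    rw [gaussianPDFReal_def]
    simp only [NNReal.coe_one, mul_one, sub_zero]
    rw [div_eq_inv_mul]
    gcongr
    · linarith [hx.1]
    · exact hx.2
  have h2 : (gaussianReal 0 1).real (Set.Ioc w (w + 1 / w)) =
      ∫ x in Set.Ioc w (w + 1 / w), gaussianPDFReal 0 1 x := by
    rw [measureReal_def, gaussianReal_apply_eq_integral 0 one_ne_zero, ENNReal.toReal_ofReal]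
    exact integral_nonneg fun x => gaussianPDFReal_nonneg _ _ _
  have h3 := setIntegral_mono_on (μ := volume) (s := Set.Ioc w (w + 1 / w))
    (integrableOn_const (by simp)) (integrable_gaussianPDFReal 0 1).integrableOn
    measurableSet_Ioc hpdf
  rw [← h2] at h3
  have h4 : (gaussianReal 0 1).real (Set.Ioc w (w + 1 / w)) ≤ upperTail w :=
    measureReal_mono Set.Ioc_subset_Ioi_self
  refine le_trans (le_of_eq ?_) (h3.trans h4)
  rw [setIntegral_const, Real.volume_real_Ioc_of_le (by linarith)]
  simp only [smul_eq_mul]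
  field_simp
  ring

theorem upperTail_pos (w : ℝ) : 0 < upperTail w := by
  have h : 0 < max w 1 := lt_max_of_lt_right one_pos
  exact lt_of_lt_of_le (by positivity)
    ((le_upperTail h).trans (upperTail_antitone (le_max_left _ _)))

theorem gaussianReal_map_affine (m : ℝ) (v : NNReal) :
    (gaussianReal 0 1).map (fun x => m + Real.sqrt v * x) = gaussianReal m v := by
  have h1 := gaussianReal_map_const_mul (μ := 0) (v := 1) (Real.sqrt v)
  have h2 := gaussianReal_map_const_add (μ := Real.sqrt v * 0)
    (v := NNReal.mk (Real.sqrt v ^ 2) (sq_nonneg _) * 1) m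
  rw [← h1, Measure.map_map (by fun_prop) (by fun_prop)] at h2
  convert h2 using 2
  · rfl
  · ring
  · apply NNReal.eq
    simp

theorem gaussianReal_real_Ioi (m a : ℝ) {v : NNReal} (hv : 0 < v) :
    (gaussianReal m v).real (Set.Ioi a) = upperTail ((a - m) / Real.sqrt v) := by
  have hs : 0 < Real.sqrt v := Real.sqrt_pos.2 hv
  rw [← gaussianReal_map_affine, map_measureReal_apply (by fun_prop) measurableSet_Ioi, upperTail]
  congr 1
  ext x
  simp only [Set.mem_preimage, Set.mem_Ioi, div_lt_iff₀ hs]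
  constructor <;> intro h <;> linarith

/-- With t the upper tail at w, the left side is t / (1 - t), and t ≤ 1/2. -/
theorem one_sub_div_upperTail_le {w : ℝ} (hw : 0 ≤ w) (hexp : Real.exp (-w ^ 2 / 2) ≤ 1 / 2) :
    1 / upperTail (-w) - 1 ≤ 2 * Real.exp (-w ^ 2 / 2) := by
  have h1 := upperTail_le_exp hw
  have h2 := upperTail_neg w
  have h3 := upperTail_pos (-w)
  have h4 := upperTail_nonneg w
  rw [sub_le_iff_le_add, div_le_iff₀ h3, h2]
  nlinarith

/-! ## Hoeffding bounds for averages -/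

variable {Ω : Type*} [MeasurableSpace Ω] {P : Measure Ω} [IsProbabilityMeasure P]

theorem hoeffding_upper {X : ℕ → Ω → ℝ} (hind : iIndepFun X P) (hm : ∀ j, Measurable (X j))
    (hb : ∀ j, ∀ᵐ ω ∂P, X j ω ∈ Set.Icc (0 : ℝ) 1) {m : ℝ} (hmean : ∀ j, ∫ ω, X j ω ∂P = m)
    {n : ℕ} {d : ℝ} (hd : 0 ≤ d) :
    P.real {ω | n * m + d ≤ ∑ j ∈ Finset.range n, X j ω} ≤ Real.exp (-2 * d ^ 2 / n) := by
  have hsub : ∀ j < n, HasSubgaussianMGF (fun ω => X j ω - m) ((‖(1 : ℝ) - 0‖₊ / 2) ^ 2) P := by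
    intro j _
    have := hasSubgaussianMGF_of_mem_Icc (hm j).aemeasurable (hb j)
    rwa [hmean j] at this
  have hind' : iIndepFun (fun j ω => X j ω - m) P :=
    hind.comp (fun _ x => x - m) (fun _ => by fun_prop)
  have h := HasSubgaussianMGF.measure_sum_range_ge_le_of_iIndepFun hind' hsub hd
  refine le_trans (le_of_eq ?_) (h.trans (le_of_eq ?_))
  · congr 1
    ext ω
    simp only [Set.mem_ofPred_eq, Finset.sum_sub_distrib, Finset.sum_const, Finset.card_range,
      nsmul_eq_mul]
    constructor <;> intro h <;> linarith
  · congr 1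
    simp
    rcases eq_or_ne (n : ℝ) 0 with h0 | h0
    · simp [h0]
    · field_simp

theorem hoeffding_lower {X : ℕ → Ω → ℝ} (hind : iIndepFun X P) (hm : ∀ j, Measurable (X j))
    (hb : ∀ j, ∀ᵐ ω ∂P, X j ω ∈ Set.Icc (0 : ℝ) 1) {m : ℝ} (hmean : ∀ j, ∫ ω, X j ω ∂P = m)
    {n : ℕ} {d : ℝ} (hd : 0 ≤ d) :
    P.real {ω | ∑ j ∈ Finset.range n, X j ω ≤ n * m - d} ≤ Real.exp (-2 * d ^ 2 / n) := by
  have hint : ∀ j, Integrable (X j) P := fun j =>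
    Integrable.of_mem_Icc 0 1 (hm j).aemeasurable (hb j)
  have h := hoeffding_upper (X := fun j ω => 1 - X j ω) (m := 1 - m) (n := n)
    (hind.comp (fun _ x => 1 - x) (fun _ => by fun_prop)) (fun j => by fun_prop)
    (fun j => by
      filter_upwards [hb j] with ω hω
      exact ⟨by linarith [hω.2], by linarith [hω.1]⟩)
    (fun j => by rw [integral_sub (integrable_const _) (hint j), hmean j]; simp) hd
  refine le_trans (le_of_eq ?_) h
  congr 1
  ext ω
  simp only [Set.mem_ofPred_eq, Finset.sum_sub_distrib, Finset.sum_const, Finset.card_range,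
    nsmul_eq_mul]
  constructor <;> intro h <;> linarith

/-- The regularised average of `j` rewards with mean `m` is rarely below `m - D`. -/
theorem regularised_average_lower {X : ℕ → Ω → ℝ} (hind : iIndepFun X P)
    (hm : ∀ j, Measurable (X j)) (hb : ∀ j, ∀ᵐ ω ∂P, X j ω ∈ Set.Icc (0 : ℝ) 1) {m : ℝ}
    (hmean : ∀ j, ∫ ω, X j ω ∂P = m) (hm1 : m ≤ 1) (j : ℕ) {D : ℝ} (hD : 0 < D) :
    P.real {ω | (∑ l ∈ Finset.range j, X l ω) / ((j : ℝ) + 1) < m - D} ≤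
      Real.exp (-(2 * D ^ 2) * ((j : ℝ) + 1) + 4 * D) := by
  have hn : (0 : ℝ) < (j : ℝ) + 1 := by positivity
  -- The sum must fall short of j m by d = (j+1)D - m. If d ≤ 0, then (j+1)D ≤ m ≤ 1 makes the
  -- exponent on the right nonnegative.
  rcases le_or_gt (((j : ℝ) + 1) * D - m) 0 with hd | hd
  · refine measureReal_le_one.trans (Real.one_le_exp ?_)
    nlinarith
  · have hset : {ω | (∑ l ∈ Finset.range j, X l ω) / ((j : ℝ) + 1) < m - D} ⊆
        {ω | ∑ l ∈ Finset.range j, X l ω ≤ j * m - (((j : ℝ) + 1) * D - m)} := by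
      intro ω hω
      simp only [Set.mem_ofPred_eq, div_lt_iff₀ hn] at hω ⊢
      nlinarith
    rcases Nat.eq_zero_or_pos j with rfl | hj
    · refine le_trans (le_of_eq ?_) (Real.exp_pos _).le
      convert measureReal_empty
      ext ω
      simp only [Nat.cast_zero, zero_add, one_mul] at hd
      simp
      linarith
    · have hj' : (0 : ℝ) < j := by exact_mod_cast hj
      refine (measureReal_mono hset).trans ((hoeffding_lower hind hm hb hmean hd.le).trans ?_)
      rw [Real.exp_le_exp, div_le_iff₀ hj']
      set d := ((j : ℝ) + 1) * D - m with hdd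
      -- Dividing by j+1 instead of j is what costs 4D: the cross term of 2d² is 4(j+1)Dm, at most
      -- 4(j+1)D.
      have h1 : ((j : ℝ) + 1) * (2 * D ^ 2 * ((j : ℝ) + 1) - 4 * D) ≤ 2 * d ^ 2 := by
        rw [hdd]; nlinarith [mul_nonneg (mul_pos hn hD).le (sub_nonneg.2 hm1), sq_nonneg m]
      rcases le_or_gt 0 (2 * D ^ 2 * ((j : ℝ) + 1) - 4 * D) with h2 | h2
      · nlinarith
      · nlinarith [sq_nonneg d]

/-- The regularised average of `j` rewards with mean `m` is rarely above `m + D`. -/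
theorem regularised_average_upper {X : ℕ → Ω → ℝ} (hind : iIndepFun X P)
    (hm : ∀ j, Measurable (X j)) (hb : ∀ j, ∀ᵐ ω ∂P, X j ω ∈ Set.Icc (0 : ℝ) 1) {m : ℝ}
    (hmean : ∀ j, ∫ ω, X j ω ∂P = m) (hm0 : 0 ≤ m) (j : ℕ) {D : ℝ} (hD : 0 < D) :
    P.real {ω | m + D < (∑ l ∈ Finset.range j, X l ω) / ((j : ℝ) + 1)} ≤
      if j = 0 then 0 else Real.exp (-(2 * D ^ 2)) ^ j := by
  split_ifs with hj
  · subst hj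
    refine le_of_eq ?_
    convert measureReal_empty
    ext ω
    simp
    linarith
  · have hj' : (0 : ℝ) < j := by exact_mod_cast Nat.pos_of_ne_zero hj
    have hn : (0 : ℝ) < (j : ℝ) + 1 := by positivity
    have hset : {ω | m + D < (∑ l ∈ Finset.range j, X l ω) / ((j : ℝ) + 1)} ⊆
        {ω | j * m + j * D ≤ ∑ l ∈ Finset.range j, X l ω} := by
      intro ω hω
      simp only [Set.mem_ofPred_eq, lt_div_iff₀ hn] at hω ⊢
      nlinarith
    refine (measureReal_mono hset).trans
      ((hoeffding_upper hind hm hb hmean (by positivity)).trans (le_of_eq ?_))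
    rw [← Real.exp_nat_mul]
    congr 1
    field_simp

end TSVHA

namespace TSVHA

/-! ## The run as a random process -/

section History

variable {K N : ℕ} {sel : (Fin K → ℝ) → Fin K} {f : (Fin N → ℝ) → ℝ}

theorem measurable_postMean (i : Fin K) :
    Measurable fun p : (Fin K → ℕ → ℝ) × (Fin K → ℕ) => postMean p.1 p.2 i := by
  refine measurable_from_prod_countable_left fun k => ?_
  have h : Measurable fun y : Fin K → ℕ → ℝ => ∑ j ∈ Finset.range (k i), y i j :=
    Finset.measurable_sum _ fun j _ => by fun_prop
  exact h.div_const ((k i : ℝ) + 1)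

theorem measurable_combinedSample (hf : Measurable f) (i : Fin K) :
    Measurable fun p : ((Fin K → ℕ → ℝ) × (Fin K → Fin N → ℝ)) × (Fin K → ℕ) =>
      combinedSample f p.1.1 p.2 p.1.2 i := by
  refine measurable_from_prod_countable_left fun k => ?_
  refine hf.comp (measurable_pi_lambda _ fun n => ?_)
  have h : Measurable fun x : (Fin K → ℕ → ℝ) × (Fin K → Fin N → ℝ) => postMean x.1 k i :=
    (measurable_postMean i).comp (measurable_fst.prodMk measurable_const)
  have h' : Measurable fun x : (Fin K → ℕ → ℝ) × (Fin K → Fin N → ℝ) => x.2 i n := by fun_prop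
  exact h.add (h'.div_const (Real.sqrt ((k i : ℝ) + 1)))

theorem measurable_chooseArm (hsel : Measurable sel) (hf : Measurable f) :
    Measurable fun p : ((Fin K → ℕ → ℝ) × (Fin K → Fin N → ℝ)) × (Fin K → ℕ) =>
      chooseArm sel f p.1.1 p.2 p.1.2 :=
  hsel.comp (measurable_pi_lambda _ fun i => measurable_combinedSample hf i)

theorem measurable_plays (hsel : Measurable sel) (hf : Measurable f) (t : ℕ) :
    Measurable fun p : (Fin K → ℕ → ℝ) × (ℕ → Fin K → Fin N → ℝ) =>
      plays sel f p.1 p.2 t := by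
  induction t with
  | zero => exact measurable_const
  | succ t ih =>
    refine measurable_pi_lambda _ fun i => ?_
    have h1 : Measurable fun p : (Fin K → ℕ → ℝ) × (ℕ → Fin K → Fin N → ℝ) =>
        chooseArm sel f p.1 (plays sel f p.1 p.2 t) (p.2 t) :=
      (measurable_chooseArm hsel hf).comp
        (Measurable.prodMk (Measurable.prodMk measurable_fst
          ((measurable_pi_apply t).comp measurable_snd)) ih)
    have h2 : Measurable fun a : Fin K => if a = i then (1 : ℕ) else 0 :=
      measurable_of_countable _
    exact ((measurable_pi_apply i).comp ih).add (h2.comp h1)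

theorem plays_congr (y : Fin K → ℕ → ℝ) {z z' : ℕ → Fin K → Fin N → ℝ} {t : ℕ}
    (h : ∀ s < t, z s = z' s) : plays sel f y z t = plays sel f y z' t := by
  induction t with
  | zero => rfl
  | succ t ih =>
    have h1 := ih fun s hs => h s (by omega)
    funext i
    simp only [plays, h1, h t (by omega)]

/-- Only the noises before round t are assumed measurable, so that Ω may carry the σ-algebra
generated by the rewards and those noises; independence from the noise of round t comes from this.
The history includes the whole reward table, even rewards not yet observed. -/
theorem measurable_history {Ω : Type*} [MeasurableSpace Ω] (hsel : Measurable sel)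
    (hf : Measurable f) {Y : Fin K → ℕ → Ω → ℝ} {Z : ℕ → Fin K → Fin N → Ω → ℝ} {t : ℕ}
    (hY : ∀ i j, Measurable (Y i j)) (hZ : ∀ s < t, ∀ i n, Measurable (Z s i n)) :
    Measurable fun ω => ((fun i j => Y i j ω : Fin K → ℕ → ℝ),
      plays sel f (fun i j => Y i j ω) (fun s i n => Z s i n ω) t) := by
  have hy : Measurable fun ω => (fun i j => Y i j ω : Fin K → ℕ → ℝ) :=
    measurable_pi_lambda _ fun i => measurable_pi_lambda _ fun j => hY i j
  refine hy.prodMk ?_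
  have h : (fun ω => plays sel f (fun i j => Y i j ω) (fun s i n => Z s i n ω) t) =
      fun ω => plays sel f (fun i j => Y i j ω)
        (fun s i n => if s < t then Z s i n ω else 0) t := by
    funext ω
    exact plays_congr _ fun s hs => by simp [hs]
  rw [h]
  refine (measurable_plays hsel hf t).comp (hy.prodMk ?_)
  refine measurable_pi_lambda _ fun s => measurable_pi_lambda _ fun i =>
    measurable_pi_lambda _ fun n => ?_
  by_cases hs : s < t
  · have h' : (fun ω => if s < t then Z s i n ω else 0) = Z s i n := funext fun ω => if_pos hs
    exact (congrArg Measurable h').mpr (hZ s hs i n)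
  · have h' : (fun ω => if s < t then Z s i n ω else 0) = fun _ => 0 := funext fun ω => if_neg hs
    exact (congrArg Measurable h').mpr measurable_const

variable {Ω : Type*} [MeasurableSpace Ω] {P : Measure Ω} {B : Bandit K}
  {Y : Fin K → ℕ → Ω → ℝ} {Z : ℕ → Fin K → Fin N → Ω → ℝ}

/-- The joint law of the sampling noises of one round. -/
noncomputable def noiseLaw (K N : ℕ) : Measure (Fin K → Fin N → ℝ) :=
  Measure.pi fun _ => Measure.pi fun _ => gaussianReal 0 1

instance : IsProbabilityMeasure (noiseLaw K N) := by
  unfold noiseLaw; infer_instance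

theorem IsRandomSource.measurable_noise_round (hYZ : IsRandomSource B P Y Z) (t : ℕ) :
    Measurable fun ω => (fun i n => Z t i n ω : Fin K → Fin N → ℝ) :=
  measurable_pi_lambda _ fun i => measurable_pi_lambda _ fun n => hYZ.measurable_noise t i n

theorem IsRandomSource.map_noise (hYZ : IsRandomSource B P Y Z) (t : ℕ) :
    P.map (fun ω => (fun i n => Z t i n ω : Fin K → Fin N → ℝ)) = noiseLaw K N := by
  have hind :=
    hYZ.indep.precomp (g := fun q : Fin K × Fin N => (Sum.inr (t, q.1, q.2) :
      (Fin K × ℕ) ⊕ (ℕ × Fin K × Fin N)))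
      (fun a b hab => by
        simp only [Sum.inr.injEq, Prod.mk.injEq, true_and] at hab
        exact Prod.ext hab.1 hab.2)
  change iIndepFun (fun q : Fin K × Fin N => Z t q.1 q.2) P at hind
  have h1 := iIndepFun.map_fun_eq_infinitePi_map
    (fun q : Fin K × Fin N => hYZ.measurable_noise t q.1 q.2) hind
  simp only [hYZ.law_noise] at h1
  have h2 := Measure.infinitePi_map_curry (fun (_ : Fin K) (_ : Fin N) => gaussianReal 0 1)
  have hm : Measurable fun ω (q : Fin K × Fin N) => Z t q.1 q.2 ω :=
    measurable_pi_lambda _ fun q => hYZ.measurable_noise t q.1 q.2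
  rw [← h1, Measure.map_map (MeasurableEquiv.measurable _) hm] at h2
  have h3 : (MeasurableEquiv.curry (Fin K) (Fin N) ℝ) ∘ (fun ω (q : Fin K × Fin N) =>
      Z t q.1 q.2 ω) = fun ω => (fun i n => Z t i n ω) := rfl
  rw [h3] at h2
  simp only [h2, noiseLaw, Measure.infinitePi_eq_pi]

theorem IsRandomSource.indep_history_noise (hYZ : IsRandomSource B P Y Z) (hsel : Measurable sel)
    (hf : Measurable f) (t : ℕ) :
    IndepFun (fun ω => ((fun i j => Y i j ω : Fin K → ℕ → ℝ),
      plays sel f (fun i j => Y i j ω) (fun s i n => Z s i n ω) t))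
      (fun ω => (fun i n => Z t i n ω : Fin K → Fin N → ℝ)) P := by
  set X : (Fin K × ℕ) ⊕ (ℕ × Fin K × Fin N) → Ω → ℝ :=
    Sum.elim (fun p => Y p.1 p.2) (fun q => Z q.1 q.2.1 q.2.2) with hX
  have hXm : ∀ a, Measurable (X a) := by
    rintro (p | q)
    · exact hYZ.measurable_reward _ _
    · exact hYZ.measurable_noise _ _ _
  -- `S` indexes all rewards and the noises of rounds before t; `S'` indexes the noise of round t.
  let S : Set ((Fin K × ℕ) ⊕ (ℕ × Fin K × Fin N)) :=
    {a | ∀ q, a = Sum.inr q → q.1 < t}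
  let S' : Set ((Fin K × ℕ) ⊕ (ℕ × Fin K × Fin N)) := {a | ∃ q, a = Sum.inr (t, q)}
  have hdisj : Disjoint S S' := by
    rw [Set.disjoint_left]
    rintro a ha ⟨q, rfl⟩
    exact lt_irrefl _ (ha _ rfl)
  have hind := indep_iSup_of_disjoint (fun a => (hXm a).comap_le)
    ((iIndepFun_iff_iIndep ..).1 hYZ.indep) hdisj
  have hcomp : ∀ (A : Set ((Fin K × ℕ) ⊕ (ℕ × Fin K × Fin N))) (a), a ∈ A →
      Measurable[⨆ a ∈ A, MeasurableSpace.comap (X a) inferInstance] (X a) := fun A a ha =>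
    (comap_measurable (X a)).mono
      (le_iSup₂ (f := fun a (_ : a ∈ A) => MeasurableSpace.comap (X a) inferInstance) a ha) le_rfl
  rw [IndepFun_iff_Indep]
  refine indep_of_indep_of_le_left (indep_of_indep_of_le_right hind ?_) ?_
  · refine Measurable.comap_le ?_
    refine @measurable_pi_lambda _ _ _ (_) _ _ fun i => @measurable_pi_lambda _ _ _ (_) _ _ fun n => ?_
    exact hcomp S' (Sum.inr (t, i, n)) ⟨(i, n), rfl⟩
  · refine Measurable.comap_le ?_
    refine @measurable_history _ _ _ _ _ (_) hsel hf Y Z t ?_ ?_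
    · exact fun i j => hcomp S (Sum.inl (i, j)) (by rintro q ⟨⟩)
    · exact fun s hs i n => hcomp S (Sum.inr (s, i, n)) (by rintro q hq; cases hq; exact hs)

/-- The noise of a round is integrated out independently of the history. -/
theorem IsRandomSource.lintegral_round [IsProbabilityMeasure P] (hYZ : IsRandomSource B P Y Z) (hsel : Measurable sel)
    (hf : Measurable f) (t : ℕ)
    {φ : (Fin K → ℕ → ℝ) → (Fin K → ℕ) → (Fin K → Fin N → ℝ) → ENNReal}
    (hφ : Measurable fun p : ((Fin K → ℕ → ℝ) × (Fin K → Fin N → ℝ)) × (Fin K → ℕ) =>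
      φ p.1.1 p.2 p.1.2) :
    ∫⁻ ω, φ (fun i j => Y i j ω)
        (plays sel f (fun i j => Y i j ω) (fun s i n => Z s i n ω) t) (fun i n => Z t i n ω) ∂P =
      ∫⁻ ω, ∫⁻ z, φ (fun i j => Y i j ω)
        (plays sel f (fun i j => Y i j ω) (fun s i n => Z s i n ω) t) z ∂(noiseLaw K N) ∂P := by
  have hW := measurable_history (t := t) hsel hf hYZ.measurable_reward
    (fun s _ => hYZ.measurable_noise s)
  have hZ := hYZ.measurable_noise_round t
  have hφ' : Measurable fun p : ((Fin K → ℕ → ℝ) × (Fin K → ℕ)) × (Fin K → Fin N → ℝ) =>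
      φ p.1.1 p.1.2 p.2 :=
    hφ.comp ((measurable_fst.fst.prodMk measurable_snd).prodMk measurable_fst.snd)
  have h := (hYZ.indep_history_noise hsel hf t).map_prod_eq_prod_map_map hW.aemeasurable
    hZ.aemeasurable
  rw [hYZ.map_noise t] at h
  have h1 := lintegral_map hφ' (hW.prodMk hZ) (μ := P)
  rw [h, lintegral_prod _ hφ'.aemeasurable, lintegral_map hφ'.lintegral_prod_right' hW] at h1
  exact h1.symm

/-- This reduces a comparison of expectations to one round with frozen history and fresh noise. -/
theorem IsRandomSource.lintegral_round_le [IsProbabilityMeasure P] (hYZ : IsRandomSource B P Y Z) (hsel : Measurable sel)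
    (hf : Measurable f) (t : ℕ)
    {φ ψ : (Fin K → ℕ → ℝ) → (Fin K → ℕ) → (Fin K → Fin N → ℝ) → ENNReal}
    (hφ : Measurable fun p : ((Fin K → ℕ → ℝ) × (Fin K → Fin N → ℝ)) × (Fin K → ℕ) =>
      φ p.1.1 p.2 p.1.2)
    (hψ : Measurable fun p : ((Fin K → ℕ → ℝ) × (Fin K → Fin N → ℝ)) × (Fin K → ℕ) =>
      ψ p.1.1 p.2 p.1.2)
    (hle : ∀ y k, ∫⁻ z, φ y k z ∂(noiseLaw K N) ≤ ∫⁻ z, ψ y k z ∂(noiseLaw K N)) :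
    ∫⁻ ω, φ (fun i j => Y i j ω)
        (plays sel f (fun i j => Y i j ω) (fun s i n => Z s i n ω) t) (fun i n => Z t i n ω) ∂P ≤
      ∫⁻ ω, ψ (fun i j => Y i j ω)
        (plays sel f (fun i j => Y i j ω) (fun s i n => Z s i n ω) t)
        (fun i n => Z t i n ω) ∂P := by
  rw [hYZ.lintegral_round hsel hf t hφ, hYZ.lintegral_round hsel hf t hψ]
  exact lintegral_mono fun ω => hle _ _

end History

end TSVHA

namespace TSVHA

/-! ## One round of the algorithm -/

section Round

variable {K N : ℕ} {sel : (Fin K → ℝ) → Fin K} {f : (Fin N → ℝ) → ℝ} {γ : ℝ}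

/-- The law of the combined samples of a round. -/
theorem map_combinedSample (hγ : 0 < γ) (hf : HasVarianceScaling f γ) (y : Fin K → ℕ → ℝ)
    (k : Fin K → ℕ) :
    (noiseLaw K N).map (fun z i => combinedSample f y k z i) =
      Measure.pi fun i => gaussianReal (postMean y k i)
        (Real.toNNReal (1 / (γ * ((k i : ℝ) + 1)))) := by
  have haff : ∀ i : Fin K, (gaussianReal 0 1).map
      (fun x => postMean y k i + x / Real.sqrt ((k i : ℝ) + 1)) =
        gaussianReal (postMean y k i) (Real.toNNReal (1 / ((k i : ℝ) + 1))) := by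
    intro i
    rw [← gaussianReal_map_affine (postMean y k i)]
    congr 1
    funext x
    rw [Real.coe_toNNReal _ (by positivity), Real.sqrt_div zero_le_one]
    simp
    ring
  have hcomp : ∀ i : Fin K, (Measure.pi fun _ : Fin N => gaussianReal 0 1).map
      (fun u => f fun n => postMean y k i + u n / Real.sqrt ((k i : ℝ) + 1)) =
        gaussianReal (postMean y k i) (Real.toNNReal (1 / (γ * ((k i : ℝ) + 1)))) := by
    intro i
    have h1 := Measure.pi_map_pi (μ := fun _ : Fin N => gaussianReal 0 1)
      (f := fun _ x => postMean y k i + x / Real.sqrt ((k i : ℝ) + 1))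
      (hμ := fun _ => by rw [haff i]; infer_instance)
      (fun _ => Measurable.aemeasurable (by fun_prop))
    simp only [haff i] at h1
    have h2 := hf.2 (postMean y k i) (Real.toNNReal (1 / ((k i : ℝ) + 1)))
      (Real.toNNReal_pos.2 (by positivity))
    rw [← h1, Measure.map_map hf.1 (measurable_pi_lambda _ fun n => by fun_prop),
      Real.coe_toNNReal _ (by positivity)] at h2
    rw [show 1 / (γ * ((k i : ℝ) + 1)) = 1 / ((k i : ℝ) + 1) / γ by field_simp]
    exact h2
  have h := Measure.pi_map_pi (μ := fun _ : Fin K => Measure.pi fun _ : Fin N => gaussianReal 0 1)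
    (f := fun i u => f fun n => postMean y k i + u n / Real.sqrt ((k i : ℝ) + 1))
    (hμ := fun i => by rw [hcomp i]; infer_instance)
    (fun i => (hf.1.comp (measurable_pi_lambda _ fun n => by fun_prop)).aemeasurable)
  simp only [hcomp] at h
  exact h

theorem gaussianReal_Ioi_sample (hγ : 0 < γ) (m c : ℝ) (j : ℕ) :
    gaussianReal m (Real.toNNReal (1 / (γ * ((j : ℝ) + 1)))) (Set.Ioi c) =
      ENNReal.ofReal (upperTail ((c - m) * Real.sqrt (γ * ((j : ℝ) + 1)))) := by
  rw [← ofReal_measureReal, gaussianReal_real_Ioi _ _ (Real.toNNReal_pos.2 (by positivity)),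
    Real.coe_toNNReal _ (by positivity), Real.sqrt_div zero_le_one]
  simp

theorem gaussianReal_Iic_sample (hγ : 0 < γ) (m c : ℝ) (j : ℕ) :
    gaussianReal m (Real.toNNReal (1 / (γ * ((j : ℝ) + 1)))) (Set.Iic c) =
      ENNReal.ofReal (1 - upperTail ((c - m) * Real.sqrt (γ * ((j : ℝ) + 1)))) := by
  rw [← Set.compl_Ioi, prob_compl_eq_one_sub measurableSet_Ioi, gaussianReal_Ioi_sample hγ,
    ENNReal.ofReal_sub _ (upperTail_nonneg _), ENNReal.ofReal_one]

theorem measurable_combinedSample_noise (hf : Measurable f) (y : Fin K → ℕ → ℝ) (k : Fin K → ℕ) :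
    Measurable fun (z : Fin K → Fin N → ℝ) i => combinedSample f y k z i :=
  measurable_pi_lambda _ fun i => (measurable_combinedSample hf i).comp
    ((measurable_const.prodMk measurable_id).prodMk measurable_const)

/-- Playing arm `i` because its sample is large is unlikely. -/
theorem noiseLaw_large_sample_le (hγ : 0 < γ) (hf : HasVarianceScaling f γ) (y : Fin K → ℕ → ℝ)
    (k : Fin K → ℕ) (i : Fin K) (c : ℝ) :
    noiseLaw K N {z | c < combinedSample f y k z i} ≤
      ENNReal.ofReal (upperTail ((c - postMean y k i) * Real.sqrt (γ * ((k i : ℝ) + 1)))) := by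
  have hm := measurable_combinedSample_noise (K := K) (N := N) hf.1 y k
  have h1 : {z : Fin K → Fin N → ℝ | c < combinedSample f y k z i} =
      (fun z i => combinedSample f y k z i) ⁻¹' {v | c < v i} := rfl
  have hs : MeasurableSet {v : Fin K → ℝ | c < v i} :=
    measurableSet_lt measurable_const (measurable_pi_apply i)
  rw [h1, ← Measure.map_apply hm hs, map_combinedSample hγ hf]
  have h2 : {v : Fin K → ℝ | c < v i} = Function.eval i ⁻¹' Set.Ioi c := rfl
  rw [h2, ← Measure.map_apply (measurable_pi_apply i) measurableSet_Ioi, Measure.pi_map_eval]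
  simp only [gaussianReal_Ioi_sample hγ, measure_univ, Finset.prod_const_one, one_smul, le_refl]

/-- If all samples are at most `c`, then arm `o` misses the chance to exceed `c` alone. -/
theorem noiseLaw_small_sample_le (hsel : IsArgmaxRule sel) (hγ : 0 < γ)
    (hf : HasVarianceScaling f γ) (y : Fin K → ℕ → ℝ) (k : Fin K → ℕ) (i o : Fin K) (c : ℝ) :
    noiseLaw K N {z | chooseArm sel f y k z = i ∧ combinedSample f y k z i ≤ c} ≤
      ENNReal.ofReal (1 / upperTail ((c - postMean y k o) * Real.sqrt (γ * ((k o : ℝ) + 1))) - 1) *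
        noiseLaw K N {z | chooseArm sel f y k z = o} := by
  have hm := measurable_combinedSample_noise (K := K) (N := N) hf.1 y k
  set μ := Measure.pi fun i => gaussianReal (postMean y k i)
        (Real.toNNReal (1 / (γ * ((k i : ℝ) + 1)))) with hμ
  have hmap : ∀ S, MeasurableSet S →
      noiseLaw K N ((fun z i => combinedSample f y k z i) ⁻¹' S) = μ S := fun S hS => by
    rw [← Measure.map_apply hm hS, map_combinedSample hγ hf]
  set p := upperTail ((c - postMean y k o) * Real.sqrt (γ * ((k o : ℝ) + 1))) with hp
  have hp0 : 0 < p := upperTail_pos _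
  have hp1 : p ≤ 1 := upperTail_le_one _
  -- `M` is the chance that every arm other than `o` stays at most c. It is a common factor of both
  -- box probabilities, so their ratio depends on `o` alone.
  set M := ∏ j ∈ Finset.univ.erase o, gaussianReal (postMean y k j)
        (Real.toNNReal (1 / (γ * ((k j : ℝ) + 1)))) (Set.Iic c) with hM
  have hbox1 : μ (Set.univ.pi fun _ => Set.Iic c) = ENNReal.ofReal (1 - p) * M := by
    rw [hμ, Measure.pi_pi, ← Finset.mul_prod_erase _ _ (Finset.mem_univ o),
      gaussianReal_Iic_sample hγ]
  have hbox2 : μ (Set.univ.pi fun j => if j = o then Set.Ioi c else Set.Iic c) =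
      ENNReal.ofReal p * M := by
    rw [hμ, Measure.pi_pi, ← Finset.mul_prod_erase _ _ (Finset.mem_univ o), if_pos rfl,
      gaussianReal_Ioi_sample hγ]
    congr 1
    exact Finset.prod_congr rfl fun j hj => by rw [if_neg (Finset.ne_of_mem_erase hj)]
  have hle1 : noiseLaw K N {z | chooseArm sel f y k z = i ∧ combinedSample f y k z i ≤ c} ≤
      ENNReal.ofReal (1 - p) * M := by
    rw [← hbox1, ← hmap _ (MeasurableSet.univ_pi fun _ => measurableSet_Iic)]
    refine measure_mono fun z hz => ?_
    obtain ⟨hz1, hz2⟩ := hz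
    intro j _
    have := hsel.2 (fun i => combinedSample f y k z i) j
    simp only [chooseArm] at hz1
    rw [hz1] at this
    exact le_trans this hz2
  have hle2 : ENNReal.ofReal p * M ≤ noiseLaw K N {z | chooseArm sel f y k z = o} := by
    rw [← hbox2, ← hmap _ (MeasurableSet.univ_pi fun j => by
      split_ifs
      · exact measurableSet_Ioi
      · exact measurableSet_Iic)]
    refine measure_mono fun z hz => ?_
    have hz' : ∀ j, combinedSample f y k z j ∈ if j = o then Set.Ioi c else Set.Iic c :=
      fun j => hz j (Set.mem_univ j)
    have ho := hz' o
    rw [if_pos rfl] at ho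
    by_contra hne
    have hne' : chooseArm sel f y k z ≠ o := hne
    have h1 := hz' (chooseArm sel f y k z)
    rw [if_neg hne'] at h1
    have h2 := hsel.2 (fun i => combinedSample f y k z i) o
    exact absurd (lt_of_lt_of_le (Set.mem_Ioi.1 ho) h2) (not_lt.2 h1)
  calc _ ≤ ENNReal.ofReal (1 - p) * M := hle1
    _ = ENNReal.ofReal (1 / p - 1) * (ENNReal.ofReal p * M) := by
        have h0 : 0 ≤ 1 / p - 1 := by
          rw [sub_nonneg, le_div_iff₀ hp0]; linarith
        rw [← mul_assoc, ← ENNReal.ofReal_mul h0]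
        congr 2
        field_simp
    _ ≤ _ := by gcongr

end Round

/-! ## Counting plays -/

open Classical in
/-- The indicator of a proposition. -/
noncomputable def ind (p : Prop) : ENNReal := if p then 1 else 0

theorem ind_of_true {p : Prop} (h : p) : ind p = 1 := if_pos h

theorem ind_of_false {p : Prop} (h : ¬p) : ind p = 0 := if_neg h

theorem ind_and (p q : Prop) : ind (p ∧ q) = ind p * ind q := by
  by_cases hp : p <;> by_cases hq : q <;> simp [ind, hp, hq]

theorem ind_le_one (p : Prop) : ind p ≤ 1 := by
  by_cases hp : p <;> simp [ind, hp]

theorem ind_mono {p q : Prop} (h : p → q) : ind p ≤ ind q := by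
  by_cases hp : p
  · rw [ind_of_true (h hp)]
    exact ind_le_one p
  · simp [ind, hp]

theorem sum_range_ind_lt (T R : ℕ) : ∑ j ∈ Finset.range T, ind (j < R) = (min T R : ℕ) := by
  induction T with
  | zero => simp
  | succ T ih =>
    rw [Finset.sum_range_succ, ih]
    by_cases h : T < R
    · rw [ind_of_true h, min_eq_left h.le, min_eq_left (Nat.succ_le_of_lt h)]
      push_cast
      rfl
    · rw [ind_of_false h, min_eq_right (not_lt.1 h), min_eq_right (by omega), add_zero]

theorem measurable_ind : Measurable ind := measurable_from_top

theorem lintegral_ind {Ω : Type*} [MeasurableSpace Ω] {P : Measure Ω} {p : Ω → Prop}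
    (hp : Measurable p) : ∫⁻ ω, ind (p ω) ∂P = P {ω | p ω} := by
  rw [← lintegral_indicator_one (measurableSet_setOfPred.2 hp)]
  exact lintegral_congr fun ω => by by_cases h : p ω <;> simp [ind, h]

section Counting

variable {K N : ℕ} {sel : (Fin K → ℝ) → Fin K} {f : (Fin N → ℝ) → ℝ}
  (y : Fin K → ℕ → ℝ) (z : ℕ → Fin K → Fin N → ℝ)

theorem plays_le (t : ℕ) (i : Fin K) : plays sel f y z t i ≤ t := by
  induction t with
  | zero => simp [plays]
  | succ t ih =>
    simp only [plays]
    split_ifs <;> omega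

theorem plays_succ (t : ℕ) (i : Fin K) : plays sel f y z (t + 1) i =
    plays sel f y z t i + if armAt sel f y z t = i then 1 else 0 := rfl

/-- Every play raises the count by one, so the counts met at the plays of an arm are 0, 1, 2, …
without repetition, and a sum over rounds becomes a sum over counts. -/
theorem sum_plays_eq (g : ℕ → ENNReal) (T : ℕ) (i : Fin K) :
    ∑ t ∈ Finset.range T, ind (armAt sel f y z t = i) * g (plays sel f y z t i) =
      ∑ j ∈ Finset.range (plays sel f y z T i), g j := by
  induction T with
  | zero => simp [plays]
  | succ T ih =>
    rw [Finset.sum_range_succ, ih, plays_succ]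
    split_ifs with h
    · rw [Finset.sum_range_succ, ind_of_true h, one_mul]
    · simp [ind_of_false h]

theorem sum_plays_le (g : ℕ → ENNReal) (T : ℕ) (i : Fin K) :
    ∑ t ∈ Finset.range T, ind (armAt sel f y z t = i) * g (plays sel f y z t i) ≤
      ∑ j ∈ Finset.range T, g j := by
  rw [sum_plays_eq]
  exact Finset.sum_le_sum_of_subset (Finset.range_subset_range.2 (plays_le y z T i))

end Counting

end TSVHA

namespace TSVHA

/-! ## Expected number of plays of an arm -/

section Expected

variable {K N : ℕ} {sel : (Fin K → ℝ) → Fin K} {f : (Fin N → ℝ) → ℝ} {γ : ℝ}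
  {Ω : Type*} [MeasurableSpace Ω] {P : Measure Ω} {B : Bandit K}
  {Y : Fin K → ℕ → Ω → ℝ} {Z : ℕ → Fin K → Fin N → Ω → ℝ}

/-- The regularised average of the first `j` rewards of an arm. -/
noncomputable def average (y : ℕ → ℝ) (j : ℕ) : ℝ :=
  (∑ l ∈ Finset.range j, y l) / ((j : ℝ) + 1)

/-- The odds that a combined sample of an arm with the given average does not exceed `c`. -/
noncomputable def missOdds (γ c m : ℝ) (j : ℕ) : ℝ :=
  1 / upperTail ((c - m) * Real.sqrt (γ * ((j : ℝ) + 1))) - 1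

theorem measurable_average {X : ℕ → Ω → ℝ} (hX : ∀ j, Measurable (X j)) (j : ℕ) :
    Measurable fun ω => average (fun l => X l ω) j :=
  (Finset.measurable_sum _ fun l _ => hX l).div_const ((j : ℝ) + 1)

theorem measurable_missOdds (γ c : ℝ) (j : ℕ) : Measurable fun m => missOdds γ c m j := by
  have h : Measurable fun m : ℝ => upperTail ((c - m) * Real.sqrt (γ * ((j : ℝ) + 1))) :=
    upperTail_antitone.measurable.comp (by fun_prop)
  exact (h.const_div 1).sub_const 1

theorem measurable_missOdds_pair (γ c : ℝ) : Measurable fun q : ℝ × ℕ => missOdds γ c q.1 q.2 := by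
  refine measurable_from_prod_countable_left ?_
  intro j
  exact measurable_missOdds γ c j

theorem IsRandomSource.measurable_round (hYZ : IsRandomSource B P Y Z) (hsel : Measurable sel)
    (hf : Measurable f) (t : ℕ) {α : Type*} [MeasurableSpace α]
    {φ : (Fin K → ℕ → ℝ) → (Fin K → ℕ) → (Fin K → Fin N → ℝ) → α}
    (hφ : Measurable fun p : ((Fin K → ℕ → ℝ) × (Fin K → Fin N → ℝ)) × (Fin K → ℕ) =>
      φ p.1.1 p.2 p.1.2) :
    Measurable fun ω => φ (fun i j => Y i j ω)
      (plays sel f (fun i j => Y i j ω) (fun s i n => Z s i n ω) t) (fun i n => Z t i n ω) := by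
  have hW := measurable_history (t := t) hsel hf hYZ.measurable_reward
    (fun s _ => hYZ.measurable_noise s)
  exact hφ.comp ((hW.fst.prodMk (hYZ.measurable_noise_round t)).prodMk hW.snd)

theorem IsRandomSource.measurable_armAt (hYZ : IsRandomSource B P Y Z) (hsel : Measurable sel)
    (hf : Measurable f) (t : ℕ) :
    Measurable fun ω => armAt sel f (fun i j => Y i j ω) (fun s i n => Z s i n ω) t :=
  hYZ.measurable_round hsel hf t (φ := fun y k z => chooseArm sel f y k z)
    (measurable_chooseArm hsel hf)

theorem measurable_plays_coord (i : Fin K) :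
    Measurable fun p : ((Fin K → ℕ → ℝ) × (Fin K → Fin N → ℝ)) × (Fin K → ℕ) => p.2 i :=
  (measurable_pi_apply i).comp measurable_snd

theorem measurable_postMean_state (i : Fin K) :
    Measurable fun p : ((Fin K → ℕ → ℝ) × (Fin K → Fin N → ℝ)) × (Fin K → ℕ) =>
      postMean p.1.1 p.2 i :=
  (measurable_postMean i).comp (measurable_fst.fst.prodMk measurable_snd)

theorem measurable_missOdds_state (γ c : ℝ) (o : Fin K) :
    Measurable fun p : ((Fin K → ℕ → ℝ) × (Fin K → Fin N → ℝ)) × (Fin K → ℕ) =>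
      missOdds γ c (postMean p.1.1 p.2 o) (p.2 o) := by
  have h : Measurable fun p : ((Fin K → ℕ → ℝ) × (Fin K → Fin N → ℝ)) × (Fin K → ℕ) =>
      (postMean p.1.1 p.2 o, p.2 o) :=
    (measurable_postMean_state o).prodMk (measurable_plays_coord o)
  simpa only [Function.comp_def] using (measurable_missOdds_pair γ c).comp h

theorem measurable_chooseArm_eq (hsel : Measurable sel) (hf : Measurable f) (i : Fin K) :
    Measurable fun p : ((Fin K → ℕ → ℝ) × (Fin K → Fin N → ℝ)) × (Fin K → ℕ) =>
      chooseArm sel f p.1.1 p.2 p.1.2 = i :=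
  measurableSet_setOfPred.1 (measurable_chooseArm hsel hf (measurableSet_singleton i))

theorem measurable_lt_prop {α : Type*} [MeasurableSpace α] {u v : α → ℝ} (hu : Measurable u)
    (hv : Measurable v) : Measurable fun a => u a < v a :=
  measurableSet_setOfPred.1 (measurableSet_lt hu hv)

theorem measurable_le_prop {α : Type*} [MeasurableSpace α] {u v : α → ℝ} (hu : Measurable u)
    (hv : Measurable v) : Measurable fun a => u a ≤ v a :=
  measurableSet_setOfPred.1 (measurableSet_le hu hv)

theorem IsRandomSource.measurable_armAt_eq (hYZ : IsRandomSource B P Y Z) (hsel : Measurable sel)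
    (hf : Measurable f) (t : ℕ) (i : Fin K) :
    Measurable fun ω => armAt sel f (fun i j => Y i j ω) (fun s i n => Z s i n ω) t = i :=
  measurableSet_setOfPred.1 (hYZ.measurable_armAt hsel hf t (measurableSet_singleton i))

theorem IsRandomSource.sum_plays_le (hYZ : IsRandomSource B P Y Z) (hsel : Measurable sel)
    (hf : Measurable f) {g : ℕ → Ω → ENNReal} (hg : ∀ j, Measurable (g j)) (T : ℕ) (i : Fin K) :
    ∑ t ∈ Finset.range T,
        ∫⁻ ω, ind (armAt sel f (fun i j => Y i j ω) (fun s i n => Z s i n ω) t = i) *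
          g (plays sel f (fun i j => Y i j ω) (fun s i n => Z s i n ω) t i) ω ∂P ≤
      ∑ j ∈ Finset.range T, ∫⁻ ω, g j ω ∂P := by
  rw [← lintegral_finsetSum _ fun j _ => hg j, ← lintegral_finsetSum]
  · exact lintegral_mono fun ω => TSVHA.sum_plays_le (sel := sel) (f := f) (fun i j => Y i j ω)
      (fun s i n => Z s i n ω) (fun j => g j ω) T i
  · intro t _
    refine (measurable_ind.comp (hYZ.measurable_armAt_eq hsel hf t i)).mul ?_
    have h1 : Measurable fun q : Ω × ℕ => g q.2 q.1 :=
      measurable_from_prod_countable_left fun j => hg j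
    have h2 := hYZ.measurable_round hsel hf t (φ := fun _ k _ => k i) (measurable_plays_coord i)
    exact h1.comp (measurable_id.prodMk h2)

theorem IsRandomSource.sum_overestimated_le (hYZ : IsRandomSource B P Y Z) (hsel : Measurable sel)
    (hf : Measurable f) (T : ℕ) (i : Fin K) (x : ℝ) :
    ∑ t ∈ Finset.range T, P {ω | armAt sel f (fun i j => Y i j ω) (fun s i n => Z s i n ω) t = i ∧
        x < postMean (fun i j => Y i j ω)
          (plays sel f (fun i j => Y i j ω) (fun s i n => Z s i n ω) t) i} ≤
      ∑ j ∈ Finset.range T, P {ω | x < average (fun l => Y i l ω) j} := by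
  have hS : ∀ j, Measurable fun ω => x < average (fun l => Y i l ω) j := fun j =>
    measurable_lt_prop measurable_const (measurable_average (hYZ.measurable_reward i) j)
  have h := hYZ.sum_plays_le hsel hf (g := fun j ω => ind (x < average (fun l => Y i l ω) j))
    (fun j => measurable_ind.comp (hS j)) T i
  simp only [lintegral_ind (hS _)] at h
  refine le_trans (le_of_eq (Finset.sum_congr rfl fun t _ => ?_)) h
  rw [← lintegral_ind]
  · exact lintegral_congr fun ω => ind_and _ _
  · exact (hYZ.measurable_armAt_eq hsel hf t i).and
      (measurable_lt_prop measurable_const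
        (hYZ.measurable_round hsel hf t (φ := fun y k _ => postMean y k i)
          (measurable_postMean_state i)))

/-- At most R plays happen while the count is below R; from then on each round costs at most δ. -/
theorem IsRandomSource.sum_large_sample_le [IsProbabilityMeasure P] (hYZ : IsRandomSource B P Y Z)
    (hsel : Measurable sel) (hγ : 0 < γ) (hf : HasVarianceScaling f γ) (T R : ℕ) (i : Fin K)
    {x c : ℝ} {δ : ENNReal}
    (hδ : ∀ j, R ≤ j → ∀ m ≤ x,
      ENNReal.ofReal (upperTail ((c - m) * Real.sqrt (γ * ((j : ℝ) + 1)))) ≤ δ) :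
    ∑ t ∈ Finset.range T, P {ω | armAt sel f (fun i j => Y i j ω) (fun s i n => Z s i n ω) t = i ∧
        postMean (fun i j => Y i j ω)
          (plays sel f (fun i j => Y i j ω) (fun s i n => Z s i n ω) t) i ≤ x ∧
        c < combinedSample f (fun i j => Y i j ω)
          (plays sel f (fun i j => Y i j ω) (fun s i n => Z s i n ω) t)
          (fun i n => Z t i n ω) i} ≤ R + T * δ := by
  have h1 := hYZ.sum_plays_le hsel hf.1 (g := fun j _ => ind (j < R))
    (fun j => measurable_const) T i
  have h2 : ∑ j ∈ Finset.range T, ∫⁻ _, ind (j < R) ∂P ≤ (R : ENNReal) := by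
    simp only [lintegral_const, measure_univ, mul_one, sum_range_ind_lt]
    exact_mod_cast min_le_right T R
  have hmeas : Measurable fun p : ((Fin K → ℕ → ℝ) × (Fin K → Fin N → ℝ)) × (Fin K → ℕ) =>
      (R ≤ p.2 i ∧ postMean p.1.1 p.2 i ≤ x) ∧ c < combinedSample f p.1.1 p.2 p.1.2 i :=
    ((measurableSet_setOfPred.1 (measurableSet_le measurable_const (measurable_plays_coord i))).and
      (measurable_le_prop (measurable_postMean_state i) measurable_const)).and
        (measurable_lt_prop measurable_const (measurable_combinedSample hf.1 i))
  have h3 : ∀ t, ∫⁻ ω, ind ((R ≤ plays sel f (fun i j => Y i j ω) (fun s i n => Z s i n ω) t i ∧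
        postMean (fun i j => Y i j ω)
          (plays sel f (fun i j => Y i j ω) (fun s i n => Z s i n ω) t) i ≤ x) ∧
        c < combinedSample f (fun i j => Y i j ω)
          (plays sel f (fun i j => Y i j ω) (fun s i n => Z s i n ω) t)
          (fun i n => Z t i n ω) i) ∂P ≤ δ := by
    intro t
    refine (hYZ.lintegral_round_le hsel hf.1 t (φ := fun y k z => ind ((R ≤ k i ∧
      postMean y k i ≤ x) ∧ c < combinedSample f y k z i)) (ψ := fun _ _ _ => δ)
      (measurable_ind.comp hmeas) measurable_const ?_).trans (by simp)
    intro y k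
    simp only [lintegral_const, measure_univ, mul_one]
    by_cases hk : R ≤ k i ∧ postMean y k i ≤ x
    · refine le_trans ?_ ((noiseLaw_large_sample_le hγ hf y k i c).trans (hδ _ hk.1 _ hk.2))
      rw [← lintegral_ind (measurable_lt_prop measurable_const
        (v := fun z => combinedSample f y k z i)
        ((measurable_pi_apply i).comp (measurable_combinedSample_noise hf.1 y k)))]
      exact lintegral_mono fun z => ind_mono fun h => h.2
    · simp [ind, hk]
  have h4 : ∀ t, P {ω | armAt sel f (fun i j => Y i j ω) (fun s i n => Z s i n ω) t = i ∧
        postMean (fun i j => Y i j ω)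
          (plays sel f (fun i j => Y i j ω) (fun s i n => Z s i n ω) t) i ≤ x ∧
        c < combinedSample f (fun i j => Y i j ω)
          (plays sel f (fun i j => Y i j ω) (fun s i n => Z s i n ω) t)
          (fun i n => Z t i n ω) i} ≤
      ∫⁻ ω, ind (armAt sel f (fun i j => Y i j ω) (fun s i n => Z s i n ω) t = i) *
        ind (plays sel f (fun i j => Y i j ω) (fun s i n => Z s i n ω) t i < R) ∂P + δ := by
    intro t
    refine le_trans ?_ (add_le_add_right (h3 t) _)
    rw [← lintegral_ind, ← lintegral_add_right]
    · refine lintegral_mono fun ω => ?_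
      dsimp only
      rw [← ind_and]
      by_cases hk : plays sel f (fun i j => Y i j ω) (fun s i n => Z s i n ω) t i < R
      · exact (ind_mono fun h => ⟨h.1, hk⟩).trans le_self_add
      · exact (ind_mono fun h => ⟨⟨not_lt.1 hk, h.2.1⟩, h.2.2⟩).trans le_add_self
    · exact measurable_ind.comp (hYZ.measurable_round hsel hf.1 t (φ := fun y k z => (R ≤ k i ∧
        postMean y k i ≤ x) ∧ c < combinedSample f y k z i) hmeas)
    · exact (hYZ.measurable_armAt_eq hsel hf.1 t i).and
        (hYZ.measurable_round hsel hf.1 t (φ := fun y k z => postMean y k i ≤ x ∧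
          c < combinedSample f y k z i)
          ((measurable_le_prop (measurable_postMean_state i) measurable_const).and
            (measurable_lt_prop measurable_const (measurable_combinedSample hf.1 i))))
  refine (Finset.sum_le_sum fun t _ => h4 t).trans ?_
  rw [Finset.sum_add_distrib]
  refine add_le_add (h1.trans h2) ?_
  simp

/-- Rounds whose odds are at most T are charged to plays of `o`. For the others a union over counts
j < T suffices: each j is paid at most once per round, hence T times in all. The cap T keeps the
later sum over r finite, which matters when the series over r diverges. -/
theorem IsRandomSource.sum_small_sample_le [IsProbabilityMeasure P] (hYZ : IsRandomSource B P Y Z)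
    (hsel : IsArgmaxRule sel) (hγ : 0 < γ) (hf : HasVarianceScaling f γ) (T : ℕ) (i o : Fin K)
    (c : ℝ) :
    ∑ t ∈ Finset.range T, P {ω | armAt sel f (fun i j => Y i j ω) (fun s i n => Z s i n ω) t = i ∧
        combinedSample f (fun i j => Y i j ω)
          (plays sel f (fun i j => Y i j ω) (fun s i n => Z s i n ω) t)
          (fun i n => Z t i n ω) i ≤ c} ≤
      ∑ j ∈ Finset.range T,
        ∫⁻ ω, min (ENNReal.ofReal (missOdds γ c (average (fun l => Y o l ω) j) j)) T ∂P := by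
  have hW : ∀ j, Measurable fun ω => missOdds γ c (average (fun l => Y o l ω) j) j := fun j =>
    (measurable_missOdds γ c j).comp (measurable_average (hYZ.measurable_reward o) j)
  have hchoose : Measurable fun p : ((Fin K → ℕ → ℝ) × (Fin K → Fin N → ℝ)) × (Fin K → ℕ) =>
      chooseArm sel f p.1.1 p.2 p.1.2 = i ∧ combinedSample f p.1.1 p.2 p.1.2 i ≤ c :=
    (measurable_chooseArm_eq hsel.1 hf.1 i).and
      (measurable_le_prop (measurable_combinedSample hf.1 i) measurable_const)
  have hle : Measurable fun p : ((Fin K → ℕ → ℝ) × (Fin K → Fin N → ℝ)) × (Fin K → ℕ) =>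
      missOdds γ c (postMean p.1.1 p.2 o) (p.2 o) ≤ (T : ℝ) :=
    measurable_le_prop (measurable_missOdds_state γ c o) measurable_const
  set G : ℕ → Ω → ENNReal := fun j ω =>
    ENNReal.ofReal (missOdds γ c (average (fun l => Y o l ω) j) j) *
      ind (missOdds γ c (average (fun l => Y o l ω) j) j ≤ T) with hG
  set G' : ℕ → Ω → ENNReal := fun j ω =>
    ind ((T : ℝ) < missOdds γ c (average (fun l => Y o l ω) j) j) with hG'
  have hGm : ∀ j, Measurable (G j) := fun j => (hW j).ennreal_ofReal.mul
    (measurable_ind.comp (measurable_le_prop (hW j) measurable_const))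
  have hGm' : ∀ j, Measurable (G' j) := fun j =>
    measurable_ind.comp (measurable_lt_prop measurable_const (hW j))
  have h1 : ∀ t, ∫⁻ ω, ind ((armAt sel f (fun i j => Y i j ω) (fun s i n => Z s i n ω) t = i ∧
        combinedSample f (fun i j => Y i j ω)
          (plays sel f (fun i j => Y i j ω) (fun s i n => Z s i n ω) t)
          (fun i n => Z t i n ω) i ≤ c) ∧ missOdds γ c (postMean (fun i j => Y i j ω)
          (plays sel f (fun i j => Y i j ω) (fun s i n => Z s i n ω) t) o)
          (plays sel f (fun i j => Y i j ω) (fun s i n => Z s i n ω) t o) ≤ T) ∂P ≤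
      ∫⁻ ω, ind (armAt sel f (fun i j => Y i j ω) (fun s i n => Z s i n ω) t = o) *
        G (plays sel f (fun i j => Y i j ω) (fun s i n => Z s i n ω) t o) ω ∂P := by
    intro t
    refine hYZ.lintegral_round_le hsel.1 hf.1 t
      (φ := fun y k z => ind ((chooseArm sel f y k z = i ∧ combinedSample f y k z i ≤ c) ∧
        missOdds γ c (postMean y k o) (k o) ≤ T))
      (ψ := fun y k z => ind (chooseArm sel f y k z = o) *
        (ENNReal.ofReal (missOdds γ c (postMean y k o) (k o)) *
          ind (missOdds γ c (postMean y k o) (k o) ≤ T)))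
      (measurable_ind.comp (hchoose.and hle))
      ((measurable_ind.comp (measurable_chooseArm_eq hsel.1 hf.1 o)).mul
        ((measurable_missOdds_state γ c o).ennreal_ofReal.mul (measurable_ind.comp hle))) ?_
    intro y k
    have hm := measurable_combinedSample_noise (K := K) (N := N) hf.1 y k
    have hm' : ∀ a, Measurable fun z : Fin K → Fin N → ℝ => chooseArm sel f y k z = a := fun a =>
      measurableSet_setOfPred.1 ((hsel.1.comp hm) (measurableSet_singleton a))
    by_cases hk : missOdds γ c (postMean y k o) (k o) ≤ T
    · simp only [hk, and_true, ind_of_true, mul_one]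
      rw [lintegral_ind ((hm' i).and (measurable_le_prop
        (u := fun z => combinedSample f y k z i) ((measurable_pi_apply i).comp hm)
        measurable_const)), lintegral_mul_const _
        (f := fun z => ind (chooseArm sel f y k z = o)) (measurable_ind.comp (hm' o)),
        lintegral_ind (hm' o), mul_comm]
      exact noiseLaw_small_sample_le hsel hγ hf y k i o c
    · simp [ind, hk]
  have h2 : ∀ t ∈ Finset.range T, P {ω | armAt sel f (fun i j => Y i j ω)
        (fun s i n => Z s i n ω) t = i ∧
        combinedSample f (fun i j => Y i j ω)
          (plays sel f (fun i j => Y i j ω) (fun s i n => Z s i n ω) t)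
          (fun i n => Z t i n ω) i ≤ c} ≤
      ∫⁻ ω, ind (armAt sel f (fun i j => Y i j ω) (fun s i n => Z s i n ω) t = o) *
        G (plays sel f (fun i j => Y i j ω) (fun s i n => Z s i n ω) t o) ω ∂P +
      ∑ j ∈ Finset.range T, ∫⁻ ω, G' j ω ∂P := by
    intro t ht
    refine le_trans ?_ (add_le_add_left (h1 t) _)
    rw [← lintegral_ind, ← lintegral_finsetSum _ fun j _ => hGm' j, ← lintegral_add_left]
    · refine lintegral_mono fun ω => ?_
      by_cases hk : missOdds γ c (postMean (fun i j => Y i j ω)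
          (plays sel f (fun i j => Y i j ω) (fun s i n => Z s i n ω) t) o)
          (plays sel f (fun i j => Y i j ω) (fun s i n => Z s i n ω) t o) ≤ T
      · exact (ind_mono fun h => ⟨h, hk⟩).trans le_self_add
      · refine le_trans ?_ le_add_self
        have hmem : plays sel f (fun i j => Y i j ω) (fun s i n => Z s i n ω) t o ∈
            Finset.range T :=
          Finset.mem_range.2 (lt_of_le_of_lt (plays_le _ _ t o) (Finset.mem_range.1 ht))
        refine le_trans ?_ (Finset.single_le_sum (f := fun j => G' j ω)
          (fun j _ => bot_le) hmem)
        refine (ind_le_one _).trans_eq (ind_of_true ?_).symm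
        exact not_le.1 hk
    · exact measurable_ind.comp (hYZ.measurable_round hsel.1 hf.1 t
        (φ := fun y k z => (chooseArm sel f y k z = i ∧ combinedSample f y k z i ≤ c) ∧
        missOdds γ c (postMean y k o) (k o) ≤ T) (hchoose.and hle))
    · exact hYZ.measurable_round hsel.1 hf.1 t
        (φ := fun y k z => chooseArm sel f y k z = i ∧ combinedSample f y k z i ≤ c) hchoose
  refine (Finset.sum_le_sum h2).trans ?_
  rw [Finset.sum_add_distrib, Finset.sum_const, Finset.card_range, nsmul_eq_mul]
  refine (add_le_add_left (hYZ.sum_plays_le hsel.1 hf.1 hGm T o) _).trans ?_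
  rw [Finset.mul_sum, ← Finset.sum_add_distrib]
  refine Finset.sum_le_sum fun j _ => ?_
  rw [← lintegral_const_mul _ (hGm' j), ← lintegral_add_left (hGm j)]
  refine lintegral_mono fun ω => ?_
  simp only [hG, hG']
  rcases le_or_gt (missOdds γ c (average (fun l => Y o l ω) j) j) T with h | h
  · rw [ind_of_true h, ind_of_false (not_lt.2 h), mul_one, mul_zero, add_zero, min_eq_left]
    exact ENNReal.ofReal_le_of_le_toReal (by simpa using h)
  · rw [ind_of_true h, ind_of_false (not_le.2 h), mul_one, mul_zero, zero_add, min_eq_right]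
    rw [← ENNReal.ofReal_natCast]
    exact ENNReal.ofReal_le_ofReal h.le

end Expected

end TSVHA

namespace TSVHA

/-! ### Layer-cake form of the odds and the three classes of plays. -/

section Expected

variable {K N : ℕ} {sel : (Fin K → ℝ) → Fin K} {f : (Fin N → ℝ) → ℝ} {γ : ℝ}
  {Ω : Type*} [MeasurableSpace Ω] {P : Measure Ω} {B : Bandit K}
  {Y : Fin K → ℕ → Ω → ℝ} {Z : ℕ → Fin K → Fin N → Ω → ℝ}

/-- A discrete layer cake. The layer below 1 is kept apart because it is controlled by the smallness
of the odds and not by a tail sum. -/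
theorem min_ofReal_natCast_le (v : ℝ) (T : ℕ) :
    min (ENNReal.ofReal v) T ≤
      min (ENNReal.ofReal v) 1 + ∑ r ∈ Finset.Ico 1 T, ind ((r : ℝ) < v) := by
  rcases Nat.eq_zero_or_pos T with rfl | hT
  · simp
  induction T, hT using Nat.le_induction with
  | base => simp
  | succ T hT ih =>
    rw [Finset.sum_Ico_succ_top hT, ← add_assoc]
    refine le_trans ?_ (add_le_add_left ih _)
    rcases lt_or_ge (T : ℝ) v with h | h
    · rw [ind_of_true h, Nat.cast_add, Nat.cast_one]
      rw [min_add]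
      exact min_le_min_right _ le_self_add
    · rw [ind_of_false (not_lt.2 h), add_zero]
      have h' : ENNReal.ofReal v ≤ T := by
        rw [← ENNReal.ofReal_natCast]
        exact ENNReal.ofReal_le_ofReal h
      rw [min_eq_left h']
      exact min_le_left _ _

/-- The layer below 1 costs at most 1 while `o` has few plays or its average is below z, and at most
δ otherwise. -/
theorem IsRandomSource.sum_lintegral_min_le [IsProbabilityMeasure P]
    (hYZ : IsRandomSource B P Y Z) (γ : ℝ) (T R : ℕ) (o : Fin K) {c z : ℝ} {δ : ENNReal}
    (hδ : ∀ j, R ≤ j → ∀ m, z ≤ m → ENNReal.ofReal (missOdds γ c m j) ≤ δ) :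
    ∑ j ∈ Finset.range T,
        ∫⁻ ω, min (ENNReal.ofReal (missOdds γ c (average (fun l => Y o l ω) j) j)) T ∂P ≤
      (R + ∑ j ∈ Finset.range T, P {ω | average (fun l => Y o l ω) j < z} + T * δ) +
        ∑ r ∈ Finset.Ico 1 T, ∑ j ∈ Finset.range T,
          P {ω | (r : ℝ) < missOdds γ c (average (fun l => Y o l ω) j) j} := by
  have havg := fun j => measurable_average (hYZ.measurable_reward o) j
  have hW : ∀ j, Measurable fun ω => missOdds γ c (average (fun l => Y o l ω) j) j := fun j =>
    (measurable_missOdds γ c j).comp (havg j)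
  have h1 : ∀ j, ∫⁻ ω, min (ENNReal.ofReal (missOdds γ c (average (fun l => Y o l ω) j) j)) T ∂P ≤
      ∫⁻ ω, min (ENNReal.ofReal (missOdds γ c (average (fun l => Y o l ω) j) j)) 1 ∂P +
        ∑ r ∈ Finset.Ico 1 T, P {ω | (r : ℝ) < missOdds γ c (average (fun l => Y o l ω) j) j} := by
    intro j
    have hr : ∀ r : ℕ, Measurable fun ω =>
        (r : ℝ) < missOdds γ c (average (fun l => Y o l ω) j) j := fun r =>
      measurable_lt_prop measurable_const (hW j)
    have hr' : ∀ r : ℕ, Measurable fun ω =>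
        ind ((r : ℝ) < missOdds γ c (average (fun l => Y o l ω) j) j) := fun r =>
      measurable_ind.comp (hr r)
    simp only [← lintegral_ind (hr _)]
    rw [← lintegral_finsetSum _ fun r _ => hr' r, ← lintegral_add_left]
    · exact lintegral_mono fun ω => min_ofReal_natCast_le _ _
    · exact (hW j).ennreal_ofReal.min measurable_const
  have h2 : ∀ j, ∫⁻ ω, min (ENNReal.ofReal (missOdds γ c (average (fun l => Y o l ω) j) j)) 1 ∂P ≤
      ind (j < R) + P {ω | average (fun l => Y o l ω) j < z} + δ := by
    intro j
    rcases lt_or_ge j R with hj | hj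
    · rw [ind_of_true hj, add_assoc]
      refine le_trans ?_ le_self_add
      refine (lintegral_mono fun ω => min_le_right _ _).trans ?_
      simp
    · rw [ind_of_false (not_lt.2 hj), zero_add,
        ← lintegral_ind (measurable_lt_prop (havg j) measurable_const)]
      have h3 : (δ : ENNReal) = ∫⁻ _, δ ∂P := by simp
      rw [h3, ← lintegral_add_right _ measurable_const]
      refine lintegral_mono fun ω => ?_
      dsimp only
      rcases lt_or_ge (average (fun l => Y o l ω) j) z with h | h
      · rw [ind_of_true h]
        exact (min_le_right _ _).trans le_self_add
      · exact (min_le_left _ _).trans ((hδ j hj _ h).trans le_add_self)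
  refine (Finset.sum_le_sum fun j _ => (h1 j).trans (add_le_add_left (h2 j) _)).trans ?_
  rw [Finset.sum_add_distrib, Finset.sum_add_distrib, Finset.sum_add_distrib, sum_range_ind_lt,
    Finset.sum_comm]
  gcongr
  · exact min_le_right _ _
  · simp

theorem ofReal_sum_measureReal [IsProbabilityMeasure P] {ι : Type*} (s : Finset ι)
    (A : ι → Set Ω) : ENNReal.ofReal (∑ t ∈ s, P.real (A t)) = ∑ t ∈ s, P (A t) := by
  rw [ENNReal.ofReal_sum_of_nonneg fun _ _ => measureReal_nonneg]
  exact Finset.sum_congr rfl fun t _ => ofReal_measureReal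

/-- Decomposition of the expected number of plays of arm `i` according to whether the average
of arm `i` exceeds `x` and its sample exceeds `c`; rounds in which it does not are charged to
plays of arm `o`. -/
theorem IsRandomSource.expected_plays_le [IsProbabilityMeasure P] (hYZ : IsRandomSource B P Y Z)
    (hsel : IsArgmaxRule sel) (hγ : 0 < γ) (hf : HasVarianceScaling f γ) (T R : ℕ) (i o : Fin K)
    {x c z δ : ℝ}
    (h₁ : ∀ j, R ≤ j → ∀ m ≤ x, upperTail ((c - m) * Real.sqrt (γ * ((j : ℝ) + 1))) ≤ δ)
    (h₂ : ∀ j, R ≤ j → ∀ m, z ≤ m → missOdds γ c m j ≤ δ) (hδ : 0 ≤ δ) :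
    ∑ t ∈ Finset.range T,
        P.real {ω | armAt sel f (fun i j => Y i j ω) (fun s i n => Z s i n ω) t = i} ≤
      ∑ j ∈ Finset.range T, P.real {ω | x < average (fun l => Y i l ω) j} + (R + T * δ) +
        (R + ∑ j ∈ Finset.range T, P.real {ω | average (fun l => Y o l ω) j < z} + T * δ +
        ∑ r ∈ Finset.Ico 1 T, ∑ j ∈ Finset.range T,
          P.real {ω | (r : ℝ) < missOdds γ c (average (fun l => Y o l ω) j) j}) := by
  have hT1 := hYZ.sum_overestimated_le hsel.1 hf.1 T i x
  have hT2 := hYZ.sum_large_sample_le hsel.1 hγ hf T R i (x := x) (c := c)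
    (δ := ENNReal.ofReal δ) fun j hj m hm => ENNReal.ofReal_le_ofReal (h₁ j hj m hm)
  have hT3 := (hYZ.sum_small_sample_le hsel hγ hf T i o c).trans
    (hYZ.sum_lintegral_min_le γ T R o (c := c) (z := z) (δ := ENNReal.ofReal δ)
      fun j hj m hm => ENNReal.ofReal_le_ofReal (h₂ j hj m hm))
  have hT := add_le_add (add_le_add hT1 hT2) hT3
  rw [← Finset.sum_add_distrib, ← Finset.sum_add_distrib] at hT
  have hsum : ∑ t ∈ Finset.range T,
      P {ω | armAt sel f (fun i j => Y i j ω) (fun s i n => Z s i n ω) t = i} ≤ _ :=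
    le_trans (Finset.sum_le_sum fun t _ => ?_) hT
  · have hn1 : 0 ≤ ∑ j ∈ Finset.range T, P.real {ω | x < average (fun l => Y i l ω) j} :=
      Finset.sum_nonneg fun _ _ => measureReal_nonneg
    have hn2 : 0 ≤ ∑ j ∈ Finset.range T, P.real {ω | average (fun l => Y o l ω) j < z} :=
      Finset.sum_nonneg fun _ _ => measureReal_nonneg
    have hn3 : ∀ r ∈ Finset.Ico 1 T, 0 ≤ ∑ j ∈ Finset.range T,
        P.real {ω | (r : ℝ) < missOdds γ c (average (fun l => Y o l ω) j) j} := fun r _ =>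
      Finset.sum_nonneg fun _ _ => measureReal_nonneg
    have hn4 := Finset.sum_nonneg hn3
    rw [← ENNReal.ofReal_le_ofReal_iff (by positivity), ofReal_sum_measureReal]
    refine hsum.trans (le_of_eq ?_)
    rw [ENNReal.ofReal_add (by positivity) (by positivity),
      ENNReal.ofReal_add (by positivity) (by positivity),
      ENNReal.ofReal_add (by positivity) (by positivity),
      ENNReal.ofReal_add (by positivity) (by positivity),
      ENNReal.ofReal_add (by positivity) (by positivity),
      ENNReal.ofReal_add (by positivity) (by positivity),
      ENNReal.ofReal_mul (by positivity), ENNReal.ofReal_natCast, ENNReal.ofReal_natCast,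
      ENNReal.ofReal_sum_of_nonneg hn3]
    simp only [ofReal_sum_measureReal]
  · refine le_trans (measure_mono (t := _ ∪ _ ∪ _) ?_)
      ((measure_union_le _ _).trans (add_le_add_left (measure_union_le _ _) _))
    intro ω hω
    simp only [Set.mem_union, Set.mem_ofPred_eq] at hω ⊢
    rcases lt_or_ge x (postMean (fun i j => Y i j ω)
          (plays sel f (fun i j => Y i j ω) (fun s i n => Z s i n ω) t) i) with h | h
    · exact Or.inl (Or.inl ⟨hω, h⟩)
    rcases lt_or_ge c (combinedSample f (fun i j => Y i j ω)
          (plays sel f (fun i j => Y i j ω) (fun s i n => Z s i n ω) t)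
          (fun i n => Z t i n ω) i) with h' | h'
    · exact Or.inl (Or.inr ⟨hω, h, h'⟩)
    · exact Or.inr ⟨hω, h'⟩

/-! ## Rewards -/

theorem IsRandomSource.indep_reward (hYZ : IsRandomSource B P Y Z) (a : Fin K) :
    iIndepFun (fun j => Y a j) P := by
  have h := hYZ.indep.precomp (g := fun j : ℕ => (Sum.inl (a, j) :
      (Fin K × ℕ) ⊕ (ℕ × Fin K × Fin N))) (fun j j' h => by simpa using h)
  exact h

theorem IsRandomSource.reward_mem (hYZ : IsRandomSource B P Y Z) (a : Fin K) (j : ℕ) :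
    ∀ᵐ ω ∂P, Y a j ω ∈ Set.Icc (0 : ℝ) 1 := by
  have h := B.support a
  rw [← hYZ.law_reward a j] at h
  exact ae_of_ae_map (hYZ.measurable_reward a j).aemeasurable h

theorem IsRandomSource.integral_reward (hYZ : IsRandomSource B P Y Z) (a : Fin K) (j : ℕ) :
    ∫ ω, Y a j ω ∂P = B.mean a := by
  rw [Bandit.mean, ← hYZ.law_reward a j,
    integral_map (hYZ.measurable_reward a j).aemeasurable (by fun_prop)]

theorem Bandit.mean_mem (B : Bandit K) (a : Fin K) : B.mean a ∈ Set.Icc (0 : ℝ) 1 := by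
  have := B.isProb a
  have hint : Integrable (fun x : ℝ => x) (B.law a) :=
    Integrable.of_mem_Icc 0 1 aemeasurable_id (B.support a)
  constructor
  · exact integral_nonneg_of_ae ((B.support a).mono fun x hx => hx.1)
  · refine (integral_mono_ae hint (integrable_const 1) ((B.support a).mono fun x hx => hx.2)).trans ?_
    simp

theorem IsRandomSource.average_lower [IsProbabilityMeasure P] (hYZ : IsRandomSource B P Y Z)
    (a : Fin K) (j : ℕ) {D : ℝ} (hD : 0 < D) :
    P.real {ω | average (fun l => Y a l ω) j < B.mean a - D} ≤
      Real.exp (-(2 * D ^ 2) * ((j : ℝ) + 1) + 4 * D) :=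
  regularised_average_lower (hYZ.indep_reward a) (hYZ.measurable_reward a) (hYZ.reward_mem a)
    (hYZ.integral_reward a) (B.mean_mem a).2 j hD

theorem IsRandomSource.average_upper [IsProbabilityMeasure P] (hYZ : IsRandomSource B P Y Z)
    (a : Fin K) (j : ℕ) {D : ℝ} (hD : 0 < D) :
    P.real {ω | B.mean a + D < average (fun l => Y a l ω) j} ≤
      if j = 0 then 0 else Real.exp (-(2 * D ^ 2)) ^ j :=
  regularised_average_upper (hYZ.indep_reward a) (hYZ.measurable_reward a) (hYZ.reward_mem a)
    (hYZ.integral_reward a) (B.mean_mem a).1 j hD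

end Expected

end TSVHA

namespace TSVHA

/-! ## Elementary estimates -/

theorem sum_exp_pow_le {a : ℝ} (ha : 0 < a) (n : ℕ) :
    ∑ k ∈ Finset.range n, Real.exp (-a) ^ k ≤ 1 + 1 / (Real.exp a - 1) := by
  have h1 : Real.exp (-a) < 1 := Real.exp_lt_one_iff.2 (by linarith)
  have h2 : 1 < Real.exp a := Real.one_lt_exp_iff.2 ha
  have h3 := (summable_geometric_of_lt_one (Real.exp_pos (-a)).le h1).sum_le_tsum
    (Finset.range n) fun _ _ => by positivity
  rw [tsum_geometric_of_lt_one (Real.exp_pos (-a)).le h1] at h3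
  refine h3.trans (le_of_eq ?_)
  have h4 : Real.exp a - 1 ≠ 0 := by linarith
  rw [Real.exp_neg] at h1 ⊢
  field_simp
  ring

theorem one_div_exp_sub_one_le {a : ℝ} (ha : 0 < a) : 1 / (Real.exp a - 1) ≤ 1 / a :=
  one_div_le_one_div_of_le ha (by linarith [Real.add_one_le_exp a])

theorem sum_exp_neg_mul_succ_le {a : ℝ} (ha : 0 < a) (n : ℕ) :
    ∑ j ∈ Finset.range n, Real.exp (-a * ((j : ℝ) + 1)) ≤ 1 / (Real.exp a - 1) := by
  have h := sum_exp_pow_le ha (n + 1)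
  rw [Finset.sum_range_succ', pow_zero] at h
  have h1 : ∀ j : ℕ, Real.exp (-a * ((j : ℝ) + 1)) = Real.exp (-a) ^ (j + 1) := fun j => by
    rw [← Real.exp_nat_mul]
    congr 1
    push_cast
    ring
  simp only [h1]
  linarith

theorem cPrime_nonneg {Δ : ℝ} (hΔ : 0 < Δ) : 0 ≤ cPrime Δ := by
  have : 1 < Real.exp (2 * Δ ^ 2 / 9) := Real.one_lt_exp_iff.2 (by positivity)
  exact div_nonneg (Real.exp_pos _).le (by linarith)

theorem one_le_cPrime {Δ : ℝ} (hΔ : 0 < Δ) (hΔ1 : Δ ≤ 1) : 1 ≤ cPrime Δ := by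
  have : 1 < Real.exp (2 * Δ ^ 2 / 9) := Real.one_lt_exp_iff.2 (by positivity)
  rw [cPrime, le_div_iff₀ (by linarith), one_mul]
  have : Real.exp (2 * Δ ^ 2 / 9) ≤ Real.exp (4 * Δ / 3) := Real.exp_le_exp.2 (by nlinarith)
  linarith

theorem cPrime_le {Δ : ℝ} (hΔ : 0 < Δ) (hΔ1 : Δ ≤ 1) : cPrime Δ ≤ 18 / Δ ^ 2 := by
  have h1 : Real.exp (4 * Δ / 3) ≤ 4 := by
    have h2 : Real.exp (4 * Δ / 3) ^ 3 ≤ 4 ^ 3 := by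
      rw [← Real.exp_nat_mul]
      calc Real.exp ((3 : ℕ) * (4 * Δ / 3)) ≤ Real.exp ((4 : ℕ) * 1) :=
            Real.exp_le_exp.2 (by push_cast; linarith)
        _ = Real.exp 1 ^ 4 := by rw [Real.exp_nat_mul]
        _ ≤ 2.7182818286 ^ 4 := by gcongr; exact Real.exp_one_lt_d9.le
        _ ≤ 4 ^ 3 := by norm_num
    exact le_of_pow_le_pow_left₀ (by norm_num) (by norm_num) h2
  have h3 := one_div_exp_sub_one_le (a := 2 * Δ ^ 2 / 9) (by positivity)
  have h4 : 1 < Real.exp (2 * Δ ^ 2 / 9) := Real.one_lt_exp_iff.2 (by positivity)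
  rw [cPrime, div_eq_mul_one_div]
  calc _ ≤ 4 * (1 / (2 * Δ ^ 2 / 9)) := by
        gcongr
    _ = 18 / Δ ^ 2 := by field_simp; norm_num

theorem sum_exp_le_cPrime {Δ : ℝ} (hΔ : 0 < Δ) (n : ℕ) :
    ∑ j ∈ Finset.range n, Real.exp (-(2 * (Δ / 3) ^ 2) * ((j : ℝ) + 1) + 4 * (Δ / 3)) ≤
      cPrime Δ := by
  simp only [Real.exp_add]
  rw [← Finset.sum_mul]
  have h := sum_exp_neg_mul_succ_le (a := 2 * (Δ / 3) ^ 2) (by positivity) n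
  rw [cPrime, show 4 * Δ / 3 = 4 * (Δ / 3) by ring, show 2 * Δ ^ 2 / 9 = 2 * (Δ / 3) ^ 2 by ring,
    div_eq_mul_one_div (Real.exp _)]
  exact (mul_le_mul_of_nonneg_right h (Real.exp_pos _).le).trans_eq (mul_comm _ _)

theorem sum_min_exp_le {D : ℝ} (hD : 0 < D) (n : ℕ) :
    ∑ j ∈ Finset.range n, min 1 (Real.exp (-(2 * D ^ 2) * ((j : ℝ) + 1) + 4 * D)) ≤
      2 / D + 1 + 1 / (2 * D ^ 2) := by
  -- From index m on the factor exp(4D) is absorbed, because (m+1)D > 2 gives 2D²(m+1) > 4D; what is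
  -- left is geometric.
  set m := ⌊2 / D⌋₊ with hm
  have hm1 : (m : ℝ) ≤ 2 / D := Nat.floor_le (by positivity)
  have hm2 : 2 < ((m : ℝ) + 1) * D := by
    have := Nat.lt_floor_add_one (2 / D)
    rwa [div_lt_iff₀ hD] at this
  calc _ ≤ ∑ j ∈ Finset.range (m + n), min 1 (Real.exp (-(2 * D ^ 2) * ((j : ℝ) + 1) + 4 * D)) :=
        Finset.sum_le_sum_of_subset_of_nonneg (Finset.range_subset_range.2 (by omega))
          fun _ _ _ => le_min zero_le_one (Real.exp_pos _).le
    _ ≤ ∑ j ∈ Finset.range m, (1 : ℝ) + ∑ k ∈ Finset.range n, Real.exp (-(2 * D ^ 2)) ^ k := by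
        rw [Finset.sum_range_add]
        refine add_le_add (Finset.sum_le_sum fun _ _ => min_le_left _ _)
          (Finset.sum_le_sum fun k _ => (min_le_right _ _).trans ?_)
        rw [← Real.exp_nat_mul, Real.exp_le_exp]
        push_cast
        nlinarith
    _ ≤ 2 / D + (1 + 1 / (2 * D ^ 2)) := by
        refine add_le_add (by simpa using hm1) ((sum_exp_pow_le (by positivity) n).trans ?_)
        have := one_div_exp_sub_one_le (a := 2 * D ^ 2) (by positivity)
        linarith
    _ = _ := by ring

/-! ### Consequences of the threshold h. -/

theorem nine_le_log {x : ℝ} (hx : 10000 ≤ x) : 9 ≤ Real.log x := by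
  rw [Real.le_log_iff_exp_le (by linarith)]
  calc Real.exp 9 = Real.exp 1 ^ 9 := by rw [← Real.exp_nat_mul]; norm_num
    _ ≤ 2.7182818286 ^ 9 := by gcongr; exact Real.exp_one_lt_d9.le
    _ ≤ 10000 := by norm_num
    _ ≤ x := hx

theorem IsThresholdH.two_mul_log_le {β h : ℝ} (hh : IsThresholdH β h) {r : ℕ} (hr : 1 < r)
    (hhr : h ≤ r) :
    2 * Real.log r ≤ (r : ℝ) ^ (1 - β / 2) / Real.sqrt (2 * β * Real.pi * Real.log r) := by
  have h1 := hh.2 r hr hhr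
  have hr0 : (0 : ℝ) < r := by positivity
  rw [← Real.le_log_iff_exp_le (by positivity), Real.log_div one_ne_zero (by positivity),
    Real.log_one, Real.log_pow] at h1
  push_cast at h1
  linarith

/-- At r = 10000 the threshold inequality would give 2 ln r ≤ 100/7, although ln r ≥ 9. This is what
allows `bigH` to pay for explicit numerical constants. -/
theorem IsThresholdH.lt {β h : ℝ} (hh : IsThresholdH β h) (hβ : 1 ≤ β) : 10000 < h := by
  by_contra hle
  have h1 := hh.two_mul_log_le (r := 10000) (by norm_num) (by push_cast; linarith)
  push_cast at h1
  have hlog : 9 ≤ Real.log 10000 := nine_le_log le_rfl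
  have h2 : (10000 : ℝ) ^ (1 - β / 2) ≤ 100 := by
    calc (10000 : ℝ) ^ (1 - β / 2) ≤ (10000 : ℝ) ^ (1 / 2 : ℝ) :=
          Real.rpow_le_rpow_of_exponent_le (by norm_num) (by linarith)
      _ = 100 := by
          rw [← Real.sqrt_eq_rpow, Real.sqrt_eq_iff_mul_self_eq] <;> norm_num
  have h3 : 7 ≤ Real.sqrt (2 * β * Real.pi * Real.log 10000) := by
    apply Real.le_sqrt_of_sq_le
    have hpi := Real.pi_gt_three
    have : 3 ≤ β * Real.pi := by nlinarith
    nlinarith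
  have h4 : (10000 : ℝ) ^ (1 - β / 2) / Real.sqrt (2 * β * Real.pi * Real.log 10000) ≤ 100 / 7 := by
    gcongr
  linarith

/-- For w² = β ln r, the main term of the Gaussian tail is 1/r times the quantity r^(1 - β/2) /
(w√(2π)) in the threshold. That quantity is at least 2 ln r ≥ 18, which covers the factor e² lost in
`le_upperTail`. -/
theorem IsThresholdH.inv_le_upperTail {β h : ℝ} (hh : IsThresholdH β h) (hβ : 1 ≤ β) {r : ℕ}
    (hhr : h ≤ r) : 1 / (r : ℝ) ≤ upperTail (Real.sqrt (β * Real.log r)) := by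
  have hr : (10000 : ℝ) ≤ r := (hh.lt hβ).le.trans hhr
  have hr0 : (0 : ℝ) < r := by linarith
  have hr1 : 1 < r := by
    have : (1 : ℝ) < r := by linarith
    exact_mod_cast this
  have hlog := nine_le_log hr
  have hQ := hh.two_mul_log_le hr1 hhr
  set w := Real.sqrt (β * Real.log r) with hw
  have hw2 : w ^ 2 = β * Real.log r := Real.sq_sqrt (by nlinarith)
  have hwpos : 0 < w := Real.sqrt_pos.2 (by nlinarith)
  refine le_trans ?_ (le_upperTail hwpos)
  have hsplit : Real.sqrt (2 * β * Real.pi * Real.log r) = w * Real.sqrt (2 * Real.pi) := by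
    rw [hw, ← Real.sqrt_mul (by nlinarith)]
    congr 1
    ring
  have hexp : Real.exp (-w ^ 2 / 2) = (r : ℝ) ^ (1 - β / 2) / r := by
    rw [hw2, Real.rpow_sub hr0, Real.rpow_one, Real.rpow_def_of_pos hr0]
    rw [show -(β * Real.log r) / 2 = -(Real.log r * (β / 2)) by ring, Real.exp_neg]
    field_simp
  have hbound : -w ^ 2 / 2 - 2 ≤ -(w + 1 / w) ^ 2 / 2 := by
    have h1 : (w + 1 / w) ^ 2 = w ^ 2 + 2 + (1 / w) ^ 2 := by
      field_simp
      ring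
    have h2 : (1 / w) ^ 2 ≤ 1 := by
      rw [one_div, inv_pow]
      exact inv_le_one_of_one_le₀ (by nlinarith)
    rw [h1]
    linarith
  have he2 : Real.exp 2 ≤ 18 := by
    calc Real.exp 2 = Real.exp 1 ^ 2 := by rw [← Real.exp_nat_mul]; norm_num
      _ ≤ 2.7182818286 ^ 2 := by gcongr; exact Real.exp_one_lt_d9.le
      _ ≤ 18 := by norm_num
  have hs : 0 < w * Real.sqrt (2 * Real.pi) := by positivity
  rw [hsplit] at hQ
  calc 1 / (r : ℝ) ≤ Real.exp (-2) * (18 / r) := by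
        rw [Real.exp_neg, ← div_eq_inv_mul, div_div, div_le_div_iff₀ hr0 (by positivity)]
        nlinarith
    _ ≤ Real.exp (-2) * ((r : ℝ) ^ (1 - β / 2) / (w * Real.sqrt (2 * Real.pi)) / r) := by
        gcongr
        linarith
    _ = Real.exp (-w ^ 2 / 2 - 2) / (w * Real.sqrt (2 * Real.pi)) := by
        rw [Real.exp_sub, hexp, Real.exp_neg]
        field_simp
    _ ≤ _ := by gcongr

/-! ## Large odds force a small average -/

/-- Odds above 1 mean that the sample exceeds c with probability below 1/2. -/
theorem lt_of_lt_missOdds {γ c m : ℝ} {j r : ℕ} (hr : 1 ≤ r) (h : (r : ℝ) < missOdds γ c m j) :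
    m < c := by
  by_contra hle
  have h1 : (c - m) * Real.sqrt (γ * ((j : ℝ) + 1)) ≤ 0 :=
    mul_nonpos_of_nonpos_of_nonneg (by linarith) (Real.sqrt_nonneg _)
  have h2 := half_le_upperTail h1
  have h3 : missOdds γ c m j ≤ 1 := by
    rw [missOdds, sub_le_iff_le_add, div_le_iff₀ (upperTail_pos _)]
    linarith
  have : (1 : ℝ) ≤ r := by exact_mod_cast hr
  linarith

/-- With a higher average the sample would exceed c with probability at least 1/r, and the odds
would be at most r - 1. -/
theorem IsThresholdH.lt_of_lt_missOdds {β h γ c m : ℝ} (hh : IsThresholdH β h) (hβ : 1 ≤ β)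
    (hγ : 0 < γ) {j r : ℕ} (hhr : h ≤ r) (hlt : (r : ℝ) < missOdds γ c m j) :
    m < c - Real.sqrt (β * Real.log r / γ) / Real.sqrt ((j : ℝ) + 1) := by
  by_contra hle
  have hs : 0 < Real.sqrt ((j : ℝ) + 1) := Real.sqrt_pos.2 (by positivity)
  have hg : 0 < Real.sqrt γ := Real.sqrt_pos.2 hγ
  have hr : (10000 : ℝ) ≤ r := (hh.lt hβ).le.trans hhr
  have hr0 : (0 : ℝ) < r := by linarith
  have hlog := nine_le_log hr
  have h1 : (c - m) * Real.sqrt (γ * ((j : ℝ) + 1)) ≤ Real.sqrt (β * Real.log r) := by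
    have h2 : c - m ≤ Real.sqrt (β * Real.log r / γ) / Real.sqrt ((j : ℝ) + 1) := by linarith
    rw [Real.sqrt_mul hγ.le]
    rw [Real.sqrt_div (by nlinarith)] at h2
    calc _ ≤ Real.sqrt (β * Real.log r) / Real.sqrt γ / Real.sqrt ((j : ℝ) + 1) *
          (Real.sqrt γ * Real.sqrt ((j : ℝ) + 1)) := by gcongr
      _ = _ := by field_simp
  have h2 := (hh.inv_le_upperTail hβ hhr).trans (upperTail_antitone h1)
  have h3 : missOdds γ c m j ≤ r := by
    rw [missOdds, sub_le_iff_le_add, div_le_iff₀ (upperTail_pos _)]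
    rw [div_le_iff₀ hr0] at h2
    nlinarith [upperTail_pos ((c - m) * Real.sqrt (γ * ((j : ℝ) + 1)))]
  linarith

/-! ### Sums over the level r: counting, zeta and integral bounds. -/

theorem sum_Ico_lt_le {a : ℝ} (ha : 0 < a) (T : ℕ) :
    ∑ r ∈ Finset.Ico 1 T, (if (r : ℝ) < a then (1 : ℝ) else 0) ≤ a := by
  rw [Finset.sum_boole]
  have hsub : (Finset.Ico 1 T).filter (fun r : ℕ => (r : ℝ) < a) ⊆ Finset.Ico 1 ⌈a⌉₊ := by
    intro r hr
    simp only [Finset.mem_filter, Finset.mem_Ico] at hr ⊢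
    exact ⟨hr.1.1, Nat.lt_ceil.2 hr.2⟩
  have hcard := Finset.card_le_card hsub
  rw [Nat.card_Ico] at hcard
  have hpos : 0 < ⌈a⌉₊ := Nat.ceil_pos.2 ha
  have h1 : ((⌈a⌉₊ - 1 : ℕ) : ℝ) ≤ a := by
    rw [Nat.cast_sub hpos]
    have := Nat.ceil_lt_add_one ha.le
    push_cast
    linarith
  exact le_trans (by exact_mod_cast hcard) h1

theorem sum_Ico_rpow_le_zetaReal {s : ℝ} (hs : 1 < s) (T : ℕ) :
    ∑ r ∈ Finset.Ico 1 T, 1 / (r : ℝ) ^ s ≤ zetaReal s := by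
  have h1 : zetaReal s = ∑' n : ℕ, 1 / (n : ℝ) ^ s := by
    rw [zetaReal, zeta_eq_tsum_one_div_nat_cpow (by simpa using hs)]
    have : ∀ n : ℕ, (1 : ℂ) / (n : ℂ) ^ (s : ℂ) = ((1 / (n : ℝ) ^ s : ℝ) : ℂ) := fun n => by
      push_cast [Complex.ofReal_cpow (Nat.cast_nonneg n)]
      rfl
    simp only [this]
    rw [← Complex.ofReal_tsum, Complex.ofReal_re]
  rw [h1]
  exact (Real.summable_one_div_nat_rpow.2 hs).sum_le_tsum _ fun _ _ => by positivity

theorem sum_Ico_rpow_le {s : ℝ} (hs0 : 0 < s) (hs1 : s < 1) {T : ℕ} (hT : 1 ≤ T) :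
    ∑ r ∈ Finset.Ico 1 T, 1 / (r : ℝ) ^ s ≤ ((T : ℝ) ^ (1 - s) - 1) / (1 - s) + 1 := by
  have hanti : AntitoneOn (fun x : ℝ => x ^ (-s)) (Set.Icc ((1 : ℕ) : ℝ) (T : ℕ)) := by
    intro x hx y hy hxy
    have hx1 : (1 : ℝ) ≤ x := by simpa using hx.1
    exact Real.rpow_le_rpow_of_nonpos (by linarith) hxy (by linarith)
  have h := hanti.sum_le_integral_Ico hT
  rw [integral_rpow (Or.inl (by linarith))] at h
  simp only [Nat.cast_one, Real.one_rpow] at h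
  have h2 : ∑ r ∈ Finset.Ico 1 T, 1 / (r : ℝ) ^ s ≤
      1 + ∑ r ∈ Finset.Ico 1 T, ((r + 1 : ℕ) : ℝ) ^ (-s) := by
    have h3 : ∀ r : ℕ, 1 / (r : ℝ) ^ s = (r : ℝ) ^ (-s) := fun r => by
      rw [Real.rpow_neg (Nat.cast_nonneg r), one_div]
    simp only [h3]
    have h4 := Finset.sum_Ico_consecutive (fun r : ℕ => (r : ℝ) ^ (-s)) (m := 1) (n := T)
      (k := T + 1) hT (by omega)
    rw [Finset.sum_Ico_add' (fun r : ℕ => (r : ℝ) ^ (-s)) 1 T 1]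
    rw [Finset.sum_eq_sum_Ico_succ_bot (by omega : 1 < T + 1)] at h4
    have h5 : 0 ≤ ∑ r ∈ Finset.Ico T (T + 1), (r : ℝ) ^ (-s) :=
      Finset.sum_nonneg fun _ _ => by positivity
    simp only [Nat.cast_one, Real.one_rpow] at h4
    linarith
  rw [show -s + 1 = 1 - s by ring] at h
  linarith

/-- Bernoulli's inequality. It serves the case 2β/γ - ε ≤ 0, where the trivial bound T on the plays
is enough. -/
theorem le_rpow_sub_one_div {u : ℝ} (hu : 1 ≤ u) {T : ℝ} (hT : 1 ≤ T) :
    T ≤ (T ^ u - 1) / u + 1 := by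
  have h := one_add_mul_self_le_rpow_one_add (s := T - 1) (by linarith) hu
  rw [show 1 + (T - 1) = T by ring] at h
  have h2 : T - 1 ≤ (T ^ u - 1) / u := by
    rw [le_div_iff₀ (by linarith)]
    linarith
  linarith

theorem zetaReal_two_nonneg : 0 ≤ zetaReal 2 := by
  have h := sum_Ico_rpow_le_zetaReal (s := 2) (by norm_num) 0
  simpa using h

end TSVHA

namespace TSVHA

/-! ### Tail sums of the averages and of the odds. -/

section Bound

variable {K N : ℕ} {sel : (Fin K → ℝ) → Fin K} {f : (Fin N → ℝ) → ℝ} {γ : ℝ}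
  {Ω : Type*} [MeasurableSpace Ω] {P : Measure Ω} [IsProbabilityMeasure P] {B : Bandit K}
  {Y : Fin K → ℕ → Ω → ℝ} {Z : ℕ → Fin K → Fin N → Ω → ℝ}

theorem IsRandomSource.sum_average_upper_le (hYZ : IsRandomSource B P Y Z) (a : Fin K) (T : ℕ)
    {D : ℝ} (hD : 0 < D) :
    ∑ j ∈ Finset.range T, P.real {ω | B.mean a + D < average (fun l => Y a l ω) j} ≤
      1 / (2 * D ^ 2) := by
  refine (Finset.sum_le_sum fun j _ => hYZ.average_upper a j hD).trans ?_
  -- With one more term the vanishing one at j = 0 can be split off; the geometric series then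
  -- starts at exponent 1 and its bound has no extra 1.
  refine (Finset.sum_le_sum_of_subset_of_nonneg (Finset.range_subset_range.2 (Nat.le_succ T))
    fun j _ _ => by split_ifs <;> positivity).trans ?_
  have h := sum_exp_pow_le (a := 2 * D ^ 2) (by positivity) (T + 1)
  have h' := one_div_exp_sub_one_le (a := 2 * D ^ 2) (by positivity)
  rw [Finset.sum_range_succ'] at h ⊢
  simp only [pow_zero, Nat.add_eq_zero_iff, one_ne_zero, and_false, if_false, if_true] at h ⊢
  linarith

theorem IsRandomSource.sum_average_lower_le (hYZ : IsRandomSource B P Y Z) (a : Fin K) (T : ℕ)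
    {D : ℝ} (hD : 0 < D) :
    ∑ j ∈ Finset.range T, P.real {ω | average (fun l => Y a l ω) j < B.mean a - D} ≤
      2 / D + 1 + 1 / (2 * D ^ 2) :=
  (Finset.sum_le_sum fun j _ => le_min measureReal_le_one (hYZ.average_lower a j hD)).trans
    (sum_min_exp_le hD T)

theorem IsRandomSource.sum_missOdds_le_cPrime (hYZ : IsRandomSource B P Y Z) (o : Fin K) (T : ℕ)
    {Δ c : ℝ} (hΔ : 0 < Δ) (hc : c ≤ B.mean o - Δ / 3) {r : ℕ} (hr : 1 ≤ r) :
    ∑ j ∈ Finset.range T,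
      P.real {ω | (r : ℝ) < missOdds γ c (average (fun l => Y o l ω) j) j} ≤ cPrime Δ := by
  refine (Finset.sum_le_sum fun j _ => ?_).trans (sum_exp_le_cPrime hΔ T)
  refine (measureReal_mono fun ω hω => ?_).trans (hYZ.average_lower o j (D := Δ / 3) (by positivity))
  exact (lt_of_lt_missOdds hr hω).trans_le hc

theorem IsRandomSource.sum_missOdds_le_cPrime_mul (hYZ : IsRandomSource B P Y Z) (hγ : 0 < γ)
    {β h : ℝ} (hh : IsThresholdH β h) (hβ : 1 ≤ β) (o : Fin K) (T : ℕ)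
    {Δ c : ℝ} (hΔ : 0 < Δ) (hc : c ≤ B.mean o - Δ / 3) {r : ℕ} (hr : h ≤ r) :
    ∑ j ∈ Finset.range T,
      P.real {ω | (r : ℝ) < missOdds γ c (average (fun l => Y o l ω) j) j} ≤
      cPrime Δ * (Real.exp (4 * Real.sqrt (β * Real.log r / γ) * (1 - Δ / 3)) /
        (r : ℝ) ^ (2 * β / γ)) := by
  set A := Real.sqrt (β * Real.log r / γ) with hA
  have hr1 : (10000 : ℝ) ≤ r := (hh.lt hβ).le.trans hr
  have hr0 : (0 : ℝ) < r := by linarith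
  have hlog := nine_le_log hr1
  have hA0 : 0 ≤ A := Real.sqrt_nonneg _
  have hA2 : A ^ 2 = β * Real.log r / γ := Real.sq_sqrt (div_nonneg (by nlinarith) hγ.le)
  have hpow : Real.exp (4 * A * (1 - Δ / 3)) / (r : ℝ) ^ (2 * β / γ) =
      Real.exp (4 * A * (1 - Δ / 3) - 2 * A ^ 2) := by
    rw [Real.exp_sub, Real.rpow_def_of_pos hr0, hA2]
    congr 2
    ring
  rw [hpow]
  refine le_trans (Finset.sum_le_sum fun j _ => ?_)
    ((Finset.sum_mul _ _ _).ge.trans (mul_le_mul_of_nonneg_right (sum_exp_le_cPrime hΔ T)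
      (Real.exp_pos _).le))
  set s := Real.sqrt ((j : ℝ) + 1) with hs
  have hs1 : 1 ≤ s := Real.one_le_sqrt.2 (by have : (0 : ℝ) ≤ j := Nat.cast_nonneg j; linarith)
  have hs2 : s ^ 2 = (j : ℝ) + 1 := Real.sq_sqrt (by positivity)
  have hs0 : 0 < s := by linarith
  have hmono : P.real {ω | (r : ℝ) < missOdds γ c (average (fun l => Y o l ω) j) j} ≤
      P.real {ω | average (fun l => Y o l ω) j < B.mean o - (Δ / 3 + A / s)} :=
    measureReal_mono fun ω hω => by
      have h1 := hh.lt_of_lt_missOdds hβ hγ hr hω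
      simp only [Set.mem_ofPred_eq]
      linarith
  refine hmono.trans ((hYZ.average_lower o j (by positivity)).trans ?_)
  rw [← Real.exp_add, Real.exp_le_exp, ← hs2]
  -- For D = Δ/3 + A/s, s ≥ 1 bounds 4A/s by 4A and the cross term 4(Δ/3)As from below by 4(Δ/3)A,
  -- leaving 4A(1 - Δ/3). The term -2A² gives r^(-2β/γ).
  have h1 : A / s ≤ A := div_le_self hA0 hs1
  have h3 : A ≤ A * s := by nlinarith
  have h4 : (Δ / 3 + A / s) ^ 2 * s ^ 2 = (Δ / 3) ^ 2 * s ^ 2 + 2 * (Δ / 3) * (A * s) + A ^ 2 := by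
    field_simp
    ring
  nlinarith

/-- The weight of the `r`-th term in the bound. -/
noncomputable def weight (g s : ℝ) (r : ℕ) : ℝ := if (r : ℝ) < g then 1 else 1 / (r : ℝ) ^ s

theorem weight_nonneg (g s : ℝ) (r : ℕ) : 0 ≤ weight g s r := by
  unfold weight; split_ifs <;> positivity

theorem sum_weight_le {g : ℝ} (hg : 0 < g) (s : ℝ) (T : ℕ) :
    ∑ r ∈ Finset.Ico 1 T, weight g s r ≤ g + ∑ r ∈ Finset.Ico 1 T, 1 / (r : ℝ) ^ s := by
  refine le_trans (Finset.sum_le_sum fun r _ => ?_)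
    (Finset.sum_add_distrib.le.trans (add_le_add_left (sum_Ico_lt_le hg T) _))
  unfold weight
  split_ifs
  · exact le_add_of_nonneg_right (by positivity)
  · simp

theorem IsRandomSource.sum_missOdds_le_weight (hYZ : IsRandomSource B P Y Z) (hγ : 0 < γ)
    {β ε h g : ℝ} (hh : IsThresholdH β h) (hβ : 1 ≤ β) (o : Fin K) (T : ℕ)
    {Δ c : ℝ} (hΔ : 0 < Δ) (hc : c ≤ B.mean o - Δ / 3) (hg : IsThresholdG γ β ε Δ g)
    {r : ℕ} (hr1 : 1 ≤ r) (hr : h ≤ r) :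
    ∑ j ∈ Finset.range T,
      P.real {ω | (r : ℝ) < missOdds γ c (average (fun l => Y o l ω) j) j} ≤
      cPrime Δ * weight g (2 * β / γ - ε) r := by
  unfold weight
  split_ifs with hrg
  · rw [mul_one]
    exact hYZ.sum_missOdds_le_cPrime o T hΔ hc hr1
  · exact (hYZ.sum_missOdds_le_cPrime_mul hγ hh hβ o T hΔ hc hr).trans
      (mul_le_mul_of_nonneg_left (hg.2 r hr1 (not_lt.1 hrg)) (cPrime_nonneg hΔ))

/-- The levels below h, where the Gaussian tail bound is unavailable, number at most h and cost c'
each. -/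
theorem IsRandomSource.sum_sum_missOdds_le (hYZ : IsRandomSource B P Y Z) (hγ : 0 < γ)
    {β ε h g : ℝ} (hh : IsThresholdH β h) (hβ : 1 ≤ β) (o : Fin K) (T : ℕ)
    {Δ c : ℝ} (hΔ : 0 < Δ) (hc : c ≤ B.mean o - Δ / 3) (hg : IsThresholdG γ β ε Δ g) :
    ∑ r ∈ Finset.Ico 1 T, ∑ j ∈ Finset.range T,
      P.real {ω | (r : ℝ) < missOdds γ c (average (fun l => Y o l ω) j) j} ≤
      cPrime Δ * h + cPrime Δ * ∑ r ∈ Finset.Ico 1 T, weight g (2 * β / γ - ε) r := by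
  have hc0 := cPrime_nonneg hΔ
  refine le_trans (Finset.sum_le_sum (g := fun r : ℕ => cPrime Δ * (if (r : ℝ) < h then 1 else 0) +
    cPrime Δ * weight g (2 * β / γ - ε) r) fun r hr => ?_) ?_
  · have hr1 := (Finset.mem_Ico.1 hr).1
    have hw := mul_nonneg hc0 (weight_nonneg g (2 * β / γ - ε) r)
    split_ifs with hrh
    · rw [mul_one]
      exact (hYZ.sum_missOdds_le_cPrime o T hΔ hc hr1).trans (by linarith)
    · rw [mul_zero, zero_add]
      exact hYZ.sum_missOdds_le_weight hγ hh hβ o T hΔ hc hg hr1 (not_lt.1 hrh)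
  · rw [Finset.sum_add_distrib, ← Finset.mul_sum, ← Finset.mul_sum]
    gcongr
    exact sum_Ico_lt_le hh.1 T

/-- If `γ` is large compared with `ln h`, then all weights below `h` are at least `1`. -/
theorem IsRandomSource.sum_sum_missOdds_le_of_log_le (hYZ : IsRandomSource B P Y Z) (hγ : 0 < γ)
    {β ε h g : ℝ} (hh : IsThresholdH β h) (hβ : β ∈ Set.Ico (1 : ℝ) 2) (o : Fin K) (T : ℕ)
    {Δ c : ℝ} (hΔ : 0 < Δ) (hΔ1 : Δ ≤ 1) (hc : c ≤ B.mean o - Δ / 3)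
    (hg : IsThresholdG γ β ε Δ g) (hlog : Real.log h ≤ 8 / 9 * γ) :
    ∑ r ∈ Finset.Ico 1 T, ∑ j ∈ Finset.range T,
      P.real {ω | (r : ℝ) < missOdds γ c (average (fun l => Y o l ω) j) j} ≤
      cPrime Δ * ∑ r ∈ Finset.Ico 1 T, weight g (2 * β / γ - ε) r := by
  have hc0 := cPrime_nonneg hΔ
  rw [Finset.mul_sum]
  refine Finset.sum_le_sum fun r hr => ?_
  have hr1 := (Finset.mem_Ico.1 hr).1
  have hr0 : (0 : ℝ) < r := by exact_mod_cast hr1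
  rcases le_or_gt h r with hrh | hrh
  · exact hYZ.sum_missOdds_le_weight hγ hh hβ.1 o T hΔ hc hg hr1 hrh
  refine (hYZ.sum_missOdds_le_cPrime o T hΔ hc hr1).trans (le_mul_of_one_le_right hc0 ?_)
  unfold weight
  split_ifs with hrg
  · exact le_rfl
  -- For g ≤ r < h the inequality defining g bounds the weight from below. Its left side is at least
  -- 1, since A ≤ 4/3 gives 2A² ≤ 4A · (2/3) ≤ 4A(1 - Δ/3).
  refine le_trans ?_ (hg.2 r hr1 (not_lt.1 hrg))
  set A := Real.sqrt (β * Real.log r / γ) with hA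
  have hlr0 : 0 ≤ Real.log r := Real.log_nonneg (by exact_mod_cast hr1)
  have hlr : Real.log r ≤ 8 / 9 * γ := (Real.log_le_log hr0 hrh.le).trans hlog
  have hA0 : 0 ≤ A := Real.sqrt_nonneg _
  have hA2 : A ^ 2 = β * Real.log r / γ :=
    Real.sq_sqrt (div_nonneg (mul_nonneg (by linarith [hβ.1]) hlr0) hγ.le)
  have hA3 : A ≤ 4 / 3 := by
    refine le_of_pow_le_pow_left₀ two_ne_zero (by norm_num) ?_
    rw [hA2, div_le_iff₀ hγ]
    nlinarith [hβ.1, hβ.2]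
  rw [one_le_div (Real.rpow_pos_of_pos hr0 _), Real.rpow_def_of_pos hr0, Real.exp_le_exp]
  have h1 : Real.log r * (2 * β / γ) = 2 * A ^ 2 := by rw [hA2]; ring
  rw [h1]
  nlinarith

end Bound

end TSVHA

namespace TSVHA

/-! ### Numerical constants and the bound on the plays of an arm. -/

section Main

/-- If γ < (9/8) ln h, then x ≤ h^(9/16). Since ln h ≤ (16/7) h^(7/16), γx is at most (18/7)h, far
below 72 h ln x. -/
theorem log_le_of_mul_log_lt {h γ x : ℝ} (hh : 10000 < h) (hx : 9.5 < x)
    (h₁ : 72 * h * Real.log x < γ * x) (h₂ : 2 * Real.log x < γ) :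
    Real.log h ≤ 8 / 9 * γ := by
  by_contra! hlt
  have hx0 : (0 : ℝ) < x := by linarith
  have hh0 : 0 < h := by linarith
  have hlx : 2 ≤ Real.log x := by
    rw [Real.le_log_iff_exp_le hx0]
    calc Real.exp 2 = Real.exp 1 ^ 2 := by rw [← Real.exp_nat_mul]; norm_num
      _ ≤ 2.7182818286 ^ 2 := by gcongr; exact Real.exp_one_lt_d9.le
      _ ≤ x := by norm_num at hx ⊢; linarith
  have hxh : x ≤ h ^ (9 / 16 : ℝ) := by
    rw [← Real.log_le_log_iff hx0 (Real.rpow_pos_of_pos hh0 _), Real.log_rpow hh0]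
    linarith
  have hlh : Real.log h ≤ h ^ (7 / 16 : ℝ) / (7 / 16) :=
    Real.log_le_rpow_div hh0.le (by norm_num)
  have hprod : h ^ (7 / 16 : ℝ) * h ^ (9 / 16 : ℝ) = h := by
    rw [← Real.rpow_add hh0]
    norm_num
  have h7 : 0 < h ^ (7 / 16 : ℝ) := Real.rpow_pos_of_pos hh0 _
  have h3 : γ * x ≤ 9 / 8 * (h ^ (7 / 16 : ℝ) / (7 / 16)) * h ^ (9 / 16 : ℝ) := by
    gcongr
    linarith
  nlinarith

variable {K N : ℕ} {sel : (Fin K → ℝ) → Fin K} {f : (Fin N → ℝ) → ℝ} {γ : ℝ}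
  {Ω : Type*} [MeasurableSpace Ω] {P : Measure Ω} {B : Bandit K}
  {Y : Fin K → ℕ → Ω → ℝ} {Z : ℕ → Fin K → Fin N → Ω → ℝ}

/-- The cutoff on j is chosen so that a margin of Δ/100 makes the exponent at least 9 ln x. -/
theorem exp_neg_sq_le_inv_pow {Δ x d : ℝ} (hγ : 0 < γ) (hΔ : 0 < Δ) (hx : 1 < x)
    (hd : Δ / 100 ≤ d) {j : ℕ} (hj : ⌊10000 * (18 * Real.log x / (γ * Δ ^ 2))⌋₊ ≤ j) :
    Real.exp (-(d * Real.sqrt (γ * ((j : ℝ) + 1))) ^ 2 / 2) ≤ 1 / x ^ 9 := by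
  have hj1 : 10000 * (18 * Real.log x / (γ * Δ ^ 2)) ≤ (j : ℝ) + 1 := by
    have h1 := Nat.lt_floor_add_one (10000 * (18 * Real.log x / (γ * Δ ^ 2)))
    have h2 : ((⌊10000 * (18 * Real.log x / (γ * Δ ^ 2))⌋₊ : ℕ) : ℝ) ≤ j := by exact_mod_cast hj
    linarith
  have hn : (0 : ℝ) < (j : ℝ) + 1 := by positivity
  rw [← mul_div_assoc, div_le_iff₀ (by positivity)] at hj1
  rw [mul_pow, Real.sq_sqrt (by positivity)]
  have h1 : 1 / x ^ 9 = Real.exp (-(9 * Real.log x)) := by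
    rw [Real.exp_neg, mul_comm, Real.exp_mul, Real.exp_log (by linarith), one_div]
    norm_cast
  rw [h1, Real.exp_le_exp]
  have h2 : (Δ / 100) ^ 2 * (γ * ((j : ℝ) + 1)) ≤ d ^ 2 * (γ * ((j : ℝ) + 1)) := by gcongr
  nlinarith

theorem const_terms_le {Δ : ℝ} (hΔ : 0 < Δ) (hΔ1 : Δ ≤ 1) :
    1 / (2 * (48 / 100 * Δ) ^ 2) + (2 / (Δ / 2) + 1 + 1 / (2 * (Δ / 2) ^ 2)) ≤ 9.2 / Δ ^ 2 := by
  have h1 : 1 / (2 * (48 / 100 * Δ) ^ 2) + (2 / (Δ / 2) + 1 + 1 / (2 * (Δ / 2) ^ 2)) =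
      (1 / (2 * (48 / 100) ^ 2) + (4 * Δ + Δ ^ 2 + 2)) / Δ ^ 2 := by
    field_simp
    ring
  have h2 : 1 / (2 * (48 / 100) ^ 2) + (4 * Δ + Δ ^ 2 + 2) ≤ 9.2 := by
    norm_num
    nlinarith
  rw [h1]
  exact div_le_div_of_nonneg_right h2 (by positivity)

theorem nine_div_sq_le {Δ l : ℝ} (hγ : 0 < γ) (hΔ : 0 < Δ) (h : γ ≤ 2 * l) :
    9 / Δ ^ 2 ≤ 18 * l / (γ * Δ ^ 2) := by
  rw [div_le_div_iff₀ (by positivity) (by positivity)]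
  have := mul_le_mul_of_nonneg_right h (sq_nonneg Δ)
  linarith

theorem IsRandomSource.expected_plays_le_missOdds [IsProbabilityMeasure P] (hYZ : IsRandomSource B P Y Z)
    (hsel : IsArgmaxRule sel) (hγ : 0 < γ) (hf : HasVarianceScaling f γ) (T : ℕ) (i o : Fin K)
    {Δ x : ℝ} (hΔ : 0 < Δ) (hΔ1 : Δ ≤ 1) (hmi : B.mean i = B.mean o - Δ)
    (hTx : (T : ℝ) * Δ ^ 2 = x) (hx9 : 9.5 < x) :
    ∑ t ∈ Finset.range T,
        P.real {ω | armAt sel f (fun i j => Y i j ω) (fun s i n => Z s i n ω) t = i} ≤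
      9.5 / Δ ^ 2 + 20000 * (18 * Real.log x / (γ * Δ ^ 2)) +
        ∑ r ∈ Finset.Ico 1 T, ∑ j ∈ Finset.range T, P.real {ω | (r : ℝ) <
          missOdds γ (B.mean i + 49 / 100 * Δ) (average (fun l => Y o l ω) j) j} := by
  have hx1 : 1 < x := by norm_num at hx9; linarith
  have hlx : 0 < Real.log x := Real.log_pos hx1
  have hR1 : ((⌊10000 * (18 * Real.log x / (γ * Δ ^ 2))⌋₊ : ℕ) : ℝ) ≤
      10000 * (18 * Real.log x / (γ * Δ ^ 2)) := Nat.floor_le (by positivity)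
  have hx9' : 1000000 ≤ x ^ 8 := by
    calc (1000000 : ℝ) ≤ 9.5 ^ 8 := by norm_num
      _ ≤ x ^ 8 := by gcongr
  -- The ninth power makes T δ = 2/(x⁸Δ²) negligible beside 9.5/Δ².
  have hTδ : T * (2 / x ^ 9) ≤ 0.01 / Δ ^ 2 := by
    have h1 : (T : ℝ) * (2 / x ^ 9) = (2 / x ^ 8) / Δ ^ 2 := by
      have hx0 : 0 < x := by linarith
      rw [(eq_div_iff (by positivity)).2 hTx]
      field_simp
    rw [h1]
    refine div_le_div_of_nonneg_right ?_ (by positivity)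
    rw [div_le_iff₀ (by positivity)]
    linarith
  have hexp_half : 1 / x ^ 9 ≤ 1 / 2 := by
    apply one_div_le_one_div_of_le (by norm_num)
    calc (2 : ℝ) ≤ 1000000 * 1 := by norm_num
      _ ≤ x ^ 8 * x := by gcongr
      _ = x ^ 9 := by ring
  -- The levels lie 0.48, 0.49 and 0.50 of the gap above the mean of `i`. Their spacing Δ/100 sets
  -- the factor 10000 = 100² in the cutoff, and their position near the middle keeps the Hoeffding
  -- constants within 9.2/Δ².
  have hmain := hYZ.expected_plays_le hsel hγ hf T
    ⌊10000 * (18 * Real.log x / (γ * Δ ^ 2))⌋₊ i o (x := B.mean i + 48 / 100 * Δ)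
    (c := B.mean i + 49 / 100 * Δ) (z := B.mean o - Δ / 2) (δ := 2 / x ^ 9)
    (fun j hj m hm => by
      have h1 : Δ / 100 ≤ B.mean i + 49 / 100 * Δ - m := by linarith
      refine (upperTail_le_exp (mul_nonneg (by linarith) (Real.sqrt_nonneg _))).trans
        ((exp_neg_sq_le_inv_pow hγ hΔ hx1 h1 hj).trans ?_)
      exact div_le_div_of_nonneg_right (by norm_num) (by positivity))
    (fun j hj m hm => by
      have h1 : Δ / 100 ≤ m - (B.mean i + 49 / 100 * Δ) := by linarith
      have h2 := exp_neg_sq_le_inv_pow hγ hΔ hx1 h1 hj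
      have h3 := one_sub_div_upperTail_le (w := (m - (B.mean i + 49 / 100 * Δ)) *
        Real.sqrt (γ * ((j : ℝ) + 1))) (mul_nonneg (by linarith) (Real.sqrt_nonneg _))
        (h2.trans hexp_half)
      rw [missOdds, ← neg_sub m, neg_mul]
      refine h3.trans ((mul_le_mul_of_nonneg_left h2 zero_le_two).trans_eq (by ring)))
    (by positivity)
  have hS1 := hYZ.sum_average_upper_le i T (D := 48 / 100 * Δ) (by positivity)
  have hS2 := hYZ.sum_average_lower_le o T (D := Δ / 2) (by positivity)
  have hS := const_terms_le hΔ hΔ1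
  have hsum : 9.5 / Δ ^ 2 = 9.2 / Δ ^ 2 + 2 * (0.01 / Δ ^ 2) + 0.28 / Δ ^ 2 := by
    rw [← mul_div_assoc, ← add_div, ← add_div]
    norm_num
  have h28 : 0 < 0.28 / Δ ^ 2 := by positivity
  linarith

/-- The bound on the expected number of plays of a suboptimal arm. -/
theorem IsRandomSource.expected_plays_bound [IsProbabilityMeasure P] (hYZ : IsRandomSource B P Y Z)
    (hsel : IsArgmaxRule sel) (hγ : 0 < γ) (hf : HasVarianceScaling f γ) {β ε h g : ℝ}
    (hβ : β ∈ Set.Ico (1 : ℝ) 2) (hh : IsThresholdH β h) (T : ℕ) (i o : Fin K)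
    (ho : B.mean o = B.best) (hΔ : 0 < B.gap i) (hg : IsThresholdG γ β ε (B.gap i) g) :
    ∑ t ∈ Finset.range T,
        P.real {ω | armAt sel f (fun i j => Y i j ω) (fun s i n => Z s i n ω) t = i} ≤
      (bigH h + 1) * (18 * max 0 (Real.log (T * B.gap i ^ 2)) / (γ * B.gap i ^ 2)) +
        9.5 / B.gap i ^ 2 +
        cPrime (B.gap i) * ∑ r ∈ Finset.Ico 1 T, weight g (2 * β / γ - ε) r := by
  have hΔ1 : B.gap i ≤ 1 := by
    rw [Bandit.gap, ← ho]
    linarith [(B.mean_mem i).1, (B.mean_mem o).2]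
  have hmi : B.mean i = B.mean o - B.gap i := by rw [Bandit.gap, ho]; ring
  generalize B.gap i = Δ at *
  obtain ⟨x, hx⟩ : ∃ x, (T : ℝ) * Δ ^ 2 = x := ⟨_, rfl⟩
  rw [hx]
  have hh4 := hh.lt hβ.1
  have hH : 4 * h ≤ bigH h := by rw [bigH]; linarith [zetaReal_two_nonneg]
  have hcM : 0 ≤ cPrime Δ * ∑ r ∈ Finset.Ico 1 T, weight g (2 * β / γ - ε) r :=
    mul_nonneg (cPrime_nonneg hΔ) (Finset.sum_nonneg fun _ _ => weight_nonneg _ _ _)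
  have hL0 : 0 ≤ 18 * max 0 (Real.log x) / (γ * Δ ^ 2) := by positivity
  have hET : ∑ t ∈ Finset.range T,
      P.real {ω | armAt sel f (fun i j => Y i j ω) (fun s i n => Z s i n ω) t = i} ≤ T := by
    refine (Finset.sum_le_sum fun t _ => measureReal_le_one).trans ?_
    simp
  -- For TΔ² ≤ 9.5 the horizon T is itself at most 9.5/Δ².
  rcases le_or_gt x 9.5 with hx9 | hx9
  · have h1 : (T : ℝ) ≤ 9.5 / Δ ^ 2 := by rwa [le_div_iff₀ (by positivity), hx]
    have h2 := mul_nonneg (by linarith : 0 ≤ bigH h + 1) hL0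
    linarith
  have hx1 : 1 < x := by norm_num at hx9; linarith
  have hlx : 0 < Real.log x := Real.log_pos hx1
  rw [max_eq_right hlx.le] at hL0 ⊢
  have h95 : 0 < 9.5 / Δ ^ 2 := by positivity
  have hmain := hYZ.expected_plays_le_missOdds hsel hγ hf T i o hΔ hΔ1 hmi hx hx9
  have hL9 := nine_div_sq_le (l := Real.log x) hγ hΔ
  have hLx : 18 * Real.log x / (γ * Δ ^ 2) * (γ * Δ ^ 2) = 18 * Real.log x :=
    div_mul_cancel₀ _ (by positivity)
  have hc : B.mean i + 49 / 100 * Δ ≤ B.mean o - Δ / 3 := by linarith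
  generalize 18 * Real.log x / (γ * Δ ^ 2) = L at *
  -- The budget is 4hL ≤ `bigH h * L`. The term 20000 L, from the cutoff used twice, takes at most
  -- 2hL, so 2hL is left for the levels below h.
  rcases le_or_gt (T : ℝ) (bigH h * L) with hTL | hTL
  · linarith
  have hHL : 4 * h * L ≤ bigH h * L := mul_le_mul_of_nonneg_right hH hL0
  have hhL : 10000 * L ≤ h * L := mul_le_mul_of_nonneg_right hh4.le hL0
  rcases le_or_gt γ (2 * Real.log x) with hγx | hγx
  · have hF := hYZ.sum_sum_missOdds_le hγ hh hβ.1 o T hΔ hc hg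
    have hch : cPrime Δ * h ≤ 2 * (h * L) := by
      calc cPrime Δ * h ≤ 18 / Δ ^ 2 * h :=
            mul_le_mul_of_nonneg_right (cPrime_le hΔ hΔ1) (by linarith)
        _ = 2 * (h * (9 / Δ ^ 2)) := by ring
        _ ≤ 2 * (h * L) := by
            have := mul_le_mul_of_nonneg_left (hL9 hγx) (by linarith : 0 ≤ h)
            linarith
    linarith
  -- Here c'h need not fit in the budget, but T > 4hL says 72 h ln x < γx. This bounds ln h by 8γ/9,
  -- and the levels below h then cost nothing extra.
  · have hlog : Real.log h ≤ 8 / 9 * γ := by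
      refine log_le_of_mul_log_lt hh4 hx9 ?_ hγx
      have h2 : 4 * h * L * (γ * Δ ^ 2) < T * (γ * Δ ^ 2) :=
        mul_lt_mul_of_pos_right (hHL.trans_lt hTL) (by positivity)
      calc 72 * h * Real.log x = 4 * h * (L * (γ * Δ ^ 2)) := by rw [hLx]; ring
        _ = 4 * h * L * (γ * Δ ^ 2) := by ring
        _ < T * (γ * Δ ^ 2) := h2
        _ = γ * x := by rw [← hx]; ring
    have hF := hYZ.sum_sum_missOdds_le_of_log_le hγ hh hβ o T hΔ hΔ1 hc hg hlog
    linarith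

/-! ### From plays to regret. -/

theorem Bandit.exists_mean_eq_best (B : Bandit K) [Nonempty (Fin K)] : ∃ o, B.mean o = B.best :=
  exists_eq_ciSup_of_finite

theorem Bandit.mean_le_best (B : Bandit K) (a : Fin K) : B.mean a ≤ B.best :=
  le_ciSup (Set.finite_range B.mean).bddAbove a

theorem regret_eq_sum (B : Bandit K) (y : Fin K → ℕ → ℝ) (z : ℕ → Fin K → Fin N → ℝ) (T : ℕ) :
    regret B sel f y z T = ∑ t ∈ Finset.range T, ∑ i ∈ B.suboptimal,
      B.gap i * (if armAt sel f y z t = i then 1 else 0) := by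
  refine Finset.sum_congr rfl fun t _ => ?_
  simp only [mul_ite, mul_one, mul_zero, Finset.sum_ite_eq]
  split_ifs with h
  · rfl
  · have h1 : ¬ B.mean (armAt sel f y z t) < B.best := fun h' =>
      h (Finset.mem_filter.2 ⟨Finset.mem_univ _, h'⟩)
    linarith [B.mean_le_best (armAt sel f y z t)]

theorem IsRandomSource.integrable_armAt [IsProbabilityMeasure P] (hYZ : IsRandomSource B P Y Z)
    (hsel : Measurable sel) (hf : Measurable f) (t : ℕ) (i : Fin K) :
    Integrable (fun ω => if armAt sel f (fun i j => Y i j ω) (fun s i n => Z s i n ω) t = i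
      then (1 : ℝ) else 0) P := by
  refine Integrable.of_bound (Measurable.aestronglyMeasurable (Measurable.ite
    (hYZ.measurable_armAt hsel hf t (measurableSet_singleton i)) measurable_const
    measurable_const)) 1 (Filter.Eventually.of_forall fun ω => ?_)
  split_ifs <;> simp

theorem IsRandomSource.integral_armAt (hYZ : IsRandomSource B P Y Z)
    (hsel : Measurable sel) (hf : Measurable f) (t : ℕ) (i : Fin K) :
    ∫ ω, (if armAt sel f (fun i j => Y i j ω) (fun s i n => Z s i n ω) t = i
      then (1 : ℝ) else 0) ∂P =
      P.real {ω | armAt sel f (fun i j => Y i j ω) (fun s i n => Z s i n ω) t = i} := by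
  have hS : MeasurableSet {ω | armAt sel f (fun i j => Y i j ω) (fun s i n => Z s i n ω) t = i} :=
    hYZ.measurable_armAt hsel hf t (measurableSet_singleton i)
  rw [← integral_indicator_one hS]
  exact integral_congr_ae (Filter.Eventually.of_forall fun ω => by
    simp [Set.indicator_apply])

theorem IsRandomSource.integrable_regret [IsProbabilityMeasure P] (hYZ : IsRandomSource B P Y Z)
    (hsel : Measurable sel) (hf : Measurable f) (T : ℕ) :
    Integrable (fun ω => regret B sel f (fun i j => Y i j ω) (fun t i n => Z t i n ω) T) P := by
  simp only [regret_eq_sum]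
  exact integrable_finsetSum _ fun t _ => integrable_finsetSum _ fun i _ =>
    (hYZ.integrable_armAt hsel hf t i).const_mul _

theorem IsRandomSource.integral_regret [IsProbabilityMeasure P] (hYZ : IsRandomSource B P Y Z)
    (hsel : Measurable sel) (hf : Measurable f) (T : ℕ) :
    ∫ ω, regret B sel f (fun i j => Y i j ω) (fun t i n => Z t i n ω) T ∂P =
      ∑ i ∈ B.suboptimal, B.gap i * ∑ t ∈ Finset.range T,
        P.real {ω | armAt sel f (fun i j => Y i j ω) (fun s i n => Z s i n ω) t = i} := by
  simp only [regret_eq_sum]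
  rw [integral_finsetSum _ fun t _ => integrable_finsetSum _ fun i _ =>
    (hYZ.integrable_armAt hsel hf t i).const_mul _]
  simp only [Finset.mul_sum]
  rw [Finset.sum_comm]
  refine Finset.sum_congr rfl fun t _ => ?_
  rw [integral_finsetSum _ fun i _ => (hYZ.integrable_armAt hsel hf t i).const_mul _]
  refine Finset.sum_congr rfl fun i _ => ?_
  rw [integral_const_mul, hYZ.integral_armAt hsel hf]

theorem Bandit.logCoeff_eq (B : Bandit K) (γ h : ℝ) (i : Fin K) (u : ℝ) (hΔ : 0 < B.gap i) :
    B.logCoeff γ h i * u = B.gap i * ((bigH h + 1) * (18 * u / (γ * B.gap i ^ 2))) := by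
  have h1 : B.upper i - B.lower i = B.gap i / 3 := by
    rw [Bandit.upper, Bandit.lower, Bandit.gap]; ring
  rw [Bandit.logCoeff, h1]
  field_simp
  ring

theorem mul_nine_half_div_sq {Δ : ℝ} (hΔ : 0 < Δ) : Δ * (9.5 / Δ ^ 2) = 9.5 / Δ := by
  field_simp

end Main

end TSVHA

open TSVHA in
theorem theorem1 {K N : ℕ} (B : TSVHA.Bandit K)
    (sel : (Fin K → ℝ) → Fin K) (hsel : TSVHA.IsArgmaxRule sel)
    (γ : ℝ) (hγ : 0 < γ)
    (f : (Fin N → ℝ) → ℝ) (hf : TSVHA.HasVarianceScaling f γ)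
    {Ω : Type*} [MeasurableSpace Ω] (P : Measure Ω) [IsProbabilityMeasure P]
    (Y : Fin K → ℕ → Ω → ℝ) (Z : ℕ → Fin K → Fin N → Ω → ℝ)
    (hYZ : TSVHA.IsRandomSource B P Y Z)
    (T : ℕ) (hT : K ≤ T)
    (β ε : ℝ) (hβ : β ∈ Set.Ico (1 : ℝ) 2) (hε : 0 < ε)
    (h : ℝ) (hh : TSVHA.IsThresholdH β h)
    (g : Fin K → ℝ) (hg : ∀ i ∈ B.suboptimal, TSVHA.IsThresholdG γ β ε (B.gap i) (g i)) :
    Integrable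
        (fun ω => TSVHA.regret B sel f (fun i j => Y i j ω) (fun t i n => Z t i n ω) T) P ∧
      (γ < 4 → 1 < 2 * β / γ - ε →
        ∫ ω, TSVHA.regret B sel f (fun i j => Y i j ω) (fun t i n => Z t i n ω) T ∂P
          ≤ ∑ i ∈ B.suboptimal,
            (B.logCoeff γ h i * max 0 (Real.log ((T : ℝ) * B.gap i ^ 2))
              + (TSVHA.cPrime (B.gap i) * (g i + TSVHA.zetaReal (2 * β / γ - ε)) + 1) * B.gap i
              + 9.5 / B.gap i)) ∧
      (4 ≤ γ →
        ∫ ω, TSVHA.regret B sel f (fun i j => Y i j ω) (fun t i n => Z t i n ω) T ∂P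
          ≤ ∑ i ∈ B.suboptimal,
            (B.logCoeff γ h i * max 0 (Real.log ((T : ℝ) * B.gap i ^ 2))
              + TSVHA.cPrime (B.gap i)
                  * (((T : ℝ) ^ (1 + ε - 2 * β / γ) - 1) / (1 + ε - 2 * β / γ) + g i + 1)
                  * B.gap i
              + 9.5 / B.gap i)) := by
  have hne : Nonempty (Fin K) := ⟨sel fun _ => 0⟩
  obtain ⟨o, ho⟩ := B.exists_mean_eq_best
  have hT1 : 1 ≤ T := le_trans (Fin.pos (Classical.arbitrary (Fin K))) hT
  have hgap : ∀ i ∈ B.suboptimal, 0 < B.gap i := fun i hi =>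
    sub_pos.2 (Finset.mem_filter.1 hi).2
  have hgap1 : ∀ i, B.gap i ≤ 1 := fun i => by
    rw [Bandit.gap, ← ho]
    linarith [(B.mean_mem i).1, (B.mean_mem o).2]
  have hbound := fun i (hi : i ∈ B.suboptimal) =>
    hYZ.expected_plays_bound hsel hγ hf hβ hh T i o ho (hgap i hi) (hg i hi)
  refine ⟨hYZ.integrable_regret hsel.1 hf.1 T, fun _ hs => ?_, fun hγ4 => ?_⟩
  · rw [hYZ.integral_regret hsel.1 hf.1 T]
    refine Finset.sum_le_sum fun i hi => ?_
    have hΔ := hgap i hi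
    have hM := (sum_weight_le (hg i hi).1 (2 * β / γ - ε) T).trans
      (add_le_add_right (sum_Ico_rpow_le_zetaReal hs T) _)
    have hcM := mul_le_mul_of_nonneg_left hM (cPrime_nonneg hΔ)
    have h1 := mul_le_mul_of_nonneg_left ((hbound i hi).trans (add_le_add_right hcM _)) hΔ.le
    rw [mul_add, mul_add, ← B.logCoeff_eq _ _ _ _ hΔ, mul_nine_half_div_sq hΔ] at h1
    linarith
  · rw [hYZ.integral_regret hsel.1 hf.1 T]
    refine Finset.sum_le_sum fun i hi => ?_
    have hΔ := hgap i hi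
    have hTr : (1 : ℝ) ≤ T := by exact_mod_cast hT1
    have hg0 := (hg i hi).1
    have hlog0 : 0 ≤ B.logCoeff γ h i * max 0 (Real.log ((T : ℝ) * B.gap i ^ 2)) := by
      rw [B.logCoeff_eq _ _ _ _ hΔ]
      have : 0 ≤ bigH h + 1 := by
        rw [bigH]
        linarith [zetaReal_two_nonneg, hh.1]
      positivity
    -- The integral comparison needs an exponent in (0, 1). Below 1 it always is, as β < 2 and γ ≥
    -- 4; if it is not positive, the right side already exceeds T times the gap, because c' ≥ 1.
    rcases le_or_gt (2 * β / γ - ε) 0 with hs | hs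
    · have h1 := le_rpow_sub_one_div (u := 1 + ε - 2 * β / γ) (by linarith) hTr
      have h2 : ∑ t ∈ Finset.range T,
          P.real {ω | armAt sel f (fun i j => Y i j ω) (fun s i n => Z s i n ω) t = i} ≤ T := by
        refine (Finset.sum_le_sum fun t _ => measureReal_le_one).trans ?_
        simp
      have h3 := one_le_cPrime hΔ (hgap1 i)
      have h4 : (T : ℝ) ≤ cPrime (B.gap i) *
          (((T : ℝ) ^ (1 + ε - 2 * β / γ) - 1) / (1 + ε - 2 * β / γ) + g i + 1) := by
        refine le_trans (by linarith) (le_mul_of_one_le_left (by linarith) h3)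
      have h5 := mul_le_mul_of_nonneg_left (h2.trans h4) hΔ.le
      have h6 : 0 < 9.5 / B.gap i := by positivity
      linarith
    · have hs1 : 2 * β / γ - ε < 1 := by
        have : 2 * β / γ < 1 := by
          rw [div_lt_one hγ]
          linarith [hβ.2]
        linarith
      have hM := (sum_weight_le hg0 (2 * β / γ - ε) T).trans
        (add_le_add_right (sum_Ico_rpow_le hs hs1 hT1) _)
      rw [show 1 - (2 * β / γ - ε) = 1 + ε - 2 * β / γ by ring] at hM
      have hcM := mul_le_mul_of_nonneg_left hM (cPrime_nonneg hΔ)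
      have h1 := mul_le_mul_of_nonneg_left ((hbound i hi).trans (add_le_add_right hcM _)) hΔ.le
      rw [mul_add, mul_add, ← B.logCoeff_eq _ _ _ _ hΔ, mul_nine_half_div_sq hΔ] at h1
      linarith
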